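/- **Theorem.** Let $j\in\{\tfrac12,1,\tfrac32,2,\dots\}$ and $d=2j+1$. Let $U:\mathrm{SU}(2)\to \mathrm{U}(d)$ be an irreducible unitary representation on $\mathcal H=\mathbb C^{d}$ (a spin-$j$ system), generated by Hermitian angular momentum operators $J^1,J^2,J^3$, i.e. $U\big(e^{\frac{i}{2}\sum_k g_k\sigma_k}\big)=e^{i\sum_k g_kJ^k}$ for all $g\in\mathbb R^3$, where $\sigma_1,\sigma_2,\sigma_3$ are the Pauli matrices. Let $\mathcal E:\mathcal B(\mathcal H)\to\mathcal B(\mathcal H)$ be a quantum channel (a completely positive, trace-preserving linear map) that is $\mathrm{SU}(2)$-covariant, i.e. $U(h)^\dagger\,\mathcal E\big(U(h)XU(h)^\dagger\big)\,U(h)=\mathcal E(X)$ for all $h\in \mathrm{SU}(2)$ and $X\in\mathcal B(\mathcal H)$. Define the unitarity of $\mathcal E$ and its average total deviation from angular-momentum conservation by $$u(\mathcal E)=\frac{d}{d-1}\int \mathrm{tr}\Big(\mathcal E\big(\psi-\tfrac{1}{d}I\big)^2\Big)\,d\psi,\qquad \Delta(\mathcal E)=\int\sum_{k=1}^{3}\big|\mathrm{tr}\big(\mathcal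 E(\psi)J^k-\psi J^k\big)\big|^2\,d\psi,$$ where the integrals are over pure states $\psi=|\psi\rangle\langle\psi|$, with $|\psi\rangle$ distributed according to the unitarily invariant probability measure on the unit sphere of $\mathcal H$. Then $$\frac{\sqrt2\,j^{1/2}}{(2j+1)^2}\,\big(1-u(\mathcal E)\big)\;\le\;\sqrt{\Delta(\mathcal E)}\;\le\;\frac{3\sqrt2\,j^{3/2}}{2j+1}\,\big(1-u(\mathcal E)\big).$$ -/

import Mathlib

open scoped Matrix ComplexOrder
open MeasureTheory

noncomputable section

namespace SpinChannel

/-- Operators on the `d`-dimensional Hilbert space `ℂ^d`, in an orthonormal basis. -/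
abbrev Op (d : ℕ) : Type := Matrix (Fin d) (Fin d) ℂ

/-- The group `SU(2)`. -/
abbrev SU2 : Type := Matrix.specialUnitaryGroup (Fin 2) ℂ

/-- The Pauli matrices `σ_x, σ_y, σ_z`. -/
def pauli : Fin 3 → Op 2 :=
  ![!![0, 1; 1, 0], !![0, -Complex.I; Complex.I, 0], !![1, 0; 0, -1]]

/-- `U` is an irreducible unitary representation of `SU(2)` on `ℂ^d`, generated by the angular
momentum operators `J 0, J 1, J 2` (along the axes `x, y, z`), that is, the group element
`exp (i g · σ / 2)` is represented by `exp (i g · J)` for every `g ∈ ℝ³`. -/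
structure IsSpinIrrep {d : ℕ} (U : SU2 →* Matrix.unitaryGroup (Fin d) ℂ)
    (J : Fin 3 → Op d) : Prop where
  hermitian : ∀ k, (J k).IsHermitian
  generates : ∀ (g : Fin 3 → ℝ) (h : SU2),
    (h : Op 2) = NormedSpace.exp (Complex.I • ∑ k, (g k : ℂ) • ((1 / 2 : ℂ) • pauli k)) →
      (U h : Op d) = NormedSpace.exp (Complex.I • ∑ k, (g k : ℂ) • J k)
  irreducible : ∀ W : Submodule ℂ (Fin d → ℂ),
    (∀ (h : SU2), ∀ w ∈ W, (U h : Op d) *ᵥ w ∈ W) → W = ⊥ ∨ W = ⊤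

/-- The map `id_k ⊗ 𝓔` on operators on `ℂ^k ⊗ ℂ^d`. -/
def ampliation {d : ℕ} (𝓔 : Op d →ₗ[ℂ] Op d) (k : ℕ)
    (M : Matrix (Fin k × Fin d) (Fin k × Fin d) ℂ) :
    Matrix (Fin k × Fin d) (Fin k × Fin d) ℂ :=
  Matrix.of fun x y => 𝓔 (Matrix.of fun i i' => M (x.1, i) (y.1, i')) x.2 y.2

/-- Quantum channels: completely positive and trace-preserving linear maps. -/
structure IsQuantumChannel {d : ℕ} (𝓔 : Op d →ₗ[ℂ] Op d) : Prop where
  completelyPositive : ∀ (k : ℕ) (M : Matrix (Fin k × Fin d) (Fin k × Fin d) ℂ),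
    M.PosSemidef → (ampliation 𝓔 k M).PosSemidef
  tracePreserving : ∀ X : Op d, (𝓔 X).trace = X.trace

/-- Covariance of `𝓔` under the action `X ↦ U(h) X U(h)†` of `SU(2)`. -/
def IsCovariant {d : ℕ} (U : SU2 →* Matrix.unitaryGroup (Fin d) ℂ)
    (𝓔 : Op d →ₗ[ℂ] Op d) : Prop :=
  ∀ (h : SU2) (X : Op d),
    (U h : Op d)ᴴ * 𝓔 ((U h : Op d) * X * (U h : Op d)ᴴ) * (U h : Op d) = 𝓔 X

/-- The rank-one operator `|ψ⟩⟨ψ|`. -/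
def pureState {d : ℕ} (ψ : EuclideanSpace ℂ (Fin d)) : Op d :=
  Matrix.of fun i i' => ψ i * star (ψ i')

/-- The average `∫ dψ f(|ψ⟩⟨ψ|)` over all pure states: the unit vector `ψ` is distributed
according to the normalized (`⨍`) surface measure of the unit sphere of `ℂ^d`, which is the
unitarily invariant probability measure. -/
def pureStateAverage {d : ℕ} (f : Op d → ℝ) : ℝ :=
  ⨍ ψ : Metric.sphere (0 : EuclideanSpace ℂ (Fin d)) 1, f (pureState (ψ : EuclideanSpace ℂ (Fin d)))
    ∂((volume : Measure (EuclideanSpace ℂ (Fin d))).toSphere)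

/-- The unitarity `u(𝓔) = d / (d - 1) ∫ tr (𝓔(ψ - 1 / d)²) dψ`. -/
def unitarity {d : ℕ} (𝓔 : Op d →ₗ[ℂ] Op d) : ℝ :=
  (d : ℝ) / ((d : ℝ) - 1) *
    pureStateAverage fun ψ => ((𝓔 (ψ - (d : ℂ)⁻¹ • (1 : Op d)) ^ 2).trace).re

/-- The directional deviation `tr (𝓔(ρ) J_k - ρ J_k)` of the `k`-th charge. -/
def directionalDeviation {d : ℕ} (J : Fin 3 → Op d) (k : Fin 3) (ρ : Op d)
    (𝓔 : Op d →ₗ[ℂ] Op d) : ℂ :=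
  (𝓔 ρ * J k - ρ * J k).trace

/-- The total deviation at the state `ρ`. -/
def totalDeviation {d : ℕ} (J : Fin 3 → Op d) (ρ : Op d) (𝓔 : Op d →ₗ[ℂ] Op d) : ℝ :=
  ∑ k, ‖directionalDeviation J k ρ 𝓔‖ ^ 2

/-- The average total deviation `Δ(𝓔)`. -/
def averageTotalDeviation {d : ℕ} (J : Fin 3 → Op d) (𝓔 : Op d →ₗ[ℂ] Op d) : ℝ :=
  pureStateAverage fun ψ => totalDeviation J ψ 𝓔

end SpinChannel

end

/-! The idea is to diagonalize the Choi operator under the rotation group. Identify ℂ^d ⊗ (ℂ^d)*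
with `Op d`; if E(ρ) = Σ K ρ K†, the Choi operator is C X = Σ ⟨K, X⟩ K for the Hilbert-Schmidt
product. It is positive, has trace d, and commutes with every `ad (J k)` when E is covariant. Under
the adjoint action `Op d` contains each spin l = 0, …, d − 1 once, with highest weight vector J₊^l.
So C is a scalar on each block; let q be its value on the identity (l = 0) and p_l its trace on the
block l, of dimension 2l + 1. Then p_l ≥ 0 and the p_l with l ≥ 1 add up to d − q.

Both sides of the theorem are averages quadratic in ψ, and the average of ψ ⊗ ψ is (1 + swap) / (d(d
+ 1)) (`integral_bilin_pureState`). By Schur's lemma E is unital, which gives 1 − u = (d² − S) / (d²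
− 1) with S = tr C² = q² + Σ p_l² / (2l + 1). Also by Schur the dual of E multiplies all J_k by one
number c, so Δ = (1 − c)² (d − 1) / 4. Pairing C with the adjoint Casimir gives t = tr (C casimir) =
Σ l(l + 1) p_l = d(d² − 1)(1 − c) / 2.

Now 2l + 1 ≥ 3 and 2 ≤ l(l + 1) ≤ d(d − 1) for 1 ≤ l ≤ d − 1. Hence q² ≤ S ≤ q² + (d − q)² / 3 and
2(d − q) ≤ t ≤ d(d − 1)(d − q), and the theorem is elementary algebra from there
(`deviation_bounds`).

The block decomposition is never constructed. `IsAngularMomentum.isPositive_of_commute` replaces it: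
operator inequalities between symmetric operators commuting with the adjoint action are tested on
the powers of J₊ alone, and become trace inequalities through `re_trace_mul_nonneg`. -/

namespace SpinChannel

/-! ### One-parameter groups and their derivatives at the identity. -/

section Exponential

variable {A : Type*} [NormedRing A] [NormedAlgebra ℂ A] [CompleteSpace A]

/-- Euler's formula for a square root of `-1`. -/
theorem exp_real_smul_of_mul_self_eq_neg_one {x : A} (hx : x * x = -1) (θ : ℝ) :
    NormedSpace.exp ((θ : ℂ) • x) = (Real.cos θ : ℂ) • (1 : A) + (Real.sin θ : ℂ) • x := by
  -- The product has zero derivative because x² = −1; its second factor is the inverse of cos t + x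
  -- sin t.
  have key : ∀ t : ℝ, NormedSpace.exp (t • x) * (Real.cos t • (1 : A) - Real.sin t • x) = 1 := by
    have hd : ∀ t : ℝ, HasDerivAt
        (fun t : ℝ => NormedSpace.exp (t • x) * (Real.cos t • (1 : A) - Real.sin t • x)) 0 t := by
      intro t
      have h1 := hasDerivAt_exp_smul_const (𝕂 := ℝ) x t
      have h2 := ((Real.hasDerivAt_cos t).smul_const (1 : A)).sub
        ((Real.hasDerivAt_sin t).smul_const x)
      convert! h1.mul h2 using 1
      rw [mul_assoc, ← mul_add]
      have h5 : x * (Real.cos t • (1 : A) - Real.sin t • x) +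
          (-Real.sin t • (1 : A) - Real.cos t • x) = 0 := by
        simp only [mul_sub, mul_smul_comm, hx, mul_one, smul_neg, neg_smul]
        abel
      exact (congrArg (NormedSpace.exp (t • x) * ·) h5).trans (mul_zero _) |>.symm
    intro t
    have hc := is_const_of_deriv_eq_zero (fun t => (hd t).differentiableAt)
      (fun t => (hd t).deriv) t 0
    simpa using hc
  have h3 : (Real.cos θ • (1 : A) - Real.sin θ • x) * (Real.cos θ • (1 : A) + Real.sin θ • x)
      = 1 := by
    simp only [sub_mul, mul_add, smul_mul_smul_comm, hx, one_mul, mul_one]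
    have : (Real.cos θ * Real.cos θ) • (1 : A) = 1 - (Real.sin θ * Real.sin θ) • (1 : A) := by
      rw [eq_sub_iff_add_eq, ← add_smul, ← sq, ← sq, Real.cos_sq_add_sin_sq, one_smul]
    rw [this, mul_comm (Real.cos θ)]
    simp only [smul_neg, sub_neg_eq_add]
    abel
  have h4 := congrArg (fun y => y * (Real.cos θ • (1 : A) + Real.sin θ • x)) (key θ)
  simp only [mul_assoc, h3, mul_one, one_mul] at h4
  simpa [← Complex.coe_smul] using h4

theorem hasDerivAt_exp_conj (x y : A) (L : A →L[ℂ] A) :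
    HasDerivAt (fun t : ℝ => L (NormedSpace.exp ((t : ℂ) • x) * y *
      NormedSpace.exp ((t : ℂ) • -x))) (L (x * y - y * x)) 0 := by
  have h1 := hasDerivAt_exp_smul_const (𝕂 := ℝ) x 0
  have h2 := hasDerivAt_exp_smul_const (𝕂 := ℝ) (-x) 0
  have h3 := (h1.mul_const y).mul h2
  have h4 := (L.restrictScalars ℝ).hasFDerivAt.comp_hasDerivAt (0 : ℝ) h3
  simp only [Complex.coe_smul]
  convert! h4 using 1
  simp [sub_eq_add_neg]

/-- Differentiating at `t = 0` turns the conjugated exponential into a conjugate of `y`;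
differentiating that at `s = 0` leaves the commutator on one side and `z` on the other. -/
theorem commutator_eq_of_exp_conj {x y z : A}
    (h : ∀ s t : ℝ, NormedSpace.exp ((s : ℂ) • x) * NormedSpace.exp ((t : ℂ) • y) *
      NormedSpace.exp ((s : ℂ) • -x) =
        NormedSpace.exp ((t : ℂ) • ((Real.cos s : ℂ) • y + (Real.sin s : ℂ) • z))) :
    x * y - y * x = z := by
  simp only [Complex.coe_smul] at h
  have h1 : ∀ s : ℝ, NormedSpace.exp (s • x) * y * NormedSpace.exp (s • -x) =
      Real.cos s • y + Real.sin s • z := by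
    intro s
    have ha := ((hasDerivAt_exp_smul_const (𝕂 := ℝ) y 0).const_mul
      (NormedSpace.exp (s • x))).mul_const (NormedSpace.exp (s • -x))
    have hb := hasDerivAt_exp_smul_const (𝕂 := ℝ) (Real.cos s • y + Real.sin s • z) 0
    simp only [h] at ha
    simpa using ha.unique hb
  have h2 := hasDerivAt_exp_conj x y (ContinuousLinearMap.id ℂ A)
  have h3 := ((Real.hasDerivAt_cos 0).smul_const y).add ((Real.hasDerivAt_sin 0).smul_const z)
  simp only [Complex.coe_smul, ContinuousLinearMap.id_apply, h1] at h2
  simpa using h2.unique h3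

theorem map_commutator_of_exp_conj {x : A} {L : A →L[ℂ] A}
    (h : ∀ (t : ℝ) (y : A), L (NormedSpace.exp ((t : ℂ) • x) * y * NormedSpace.exp ((t : ℂ) • -x))
      = NormedSpace.exp ((t : ℂ) • x) * L y * NormedSpace.exp ((t : ℂ) • -x)) (y : A) :
    L (x * y - y * x) = x * L y - L y * x := by
  have h1 := hasDerivAt_exp_conj x y L
  have h2 := hasDerivAt_exp_conj x (L y) (ContinuousLinearMap.id ℂ A)
  simp only [h] at h1
  exact h1.unique h2

end Exponential

section MatrixExponential

variable {m : Type*} [Fintype m] [DecidableEq m]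

open scoped Matrix.Norms.Operator

theorem matrix_exp_real_smul_of_mul_self_eq_neg_one {x : Matrix m m ℂ} (hx : x * x = -1) (θ : ℝ) :
    NormedSpace.exp ((θ : ℂ) • x) =
      (Real.cos θ : ℂ) • (1 : Matrix m m ℂ) + (Real.sin θ : ℂ) • x :=
  exp_real_smul_of_mul_self_eq_neg_one hx θ

theorem matrix_commutator_eq_of_exp_conj {x y z : Matrix m m ℂ}
    (h : ∀ s t : ℝ, NormedSpace.exp ((s : ℂ) • x) * NormedSpace.exp ((t : ℂ) • y) *
      NormedSpace.exp ((s : ℂ) • -x) =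
        NormedSpace.exp ((t : ℂ) • ((Real.cos s : ℂ) • y + (Real.sin s : ℂ) • z))) :
    x * y - y * x = z :=
  commutator_eq_of_exp_conj h

theorem matrix_map_commutator_of_exp_conj {x : Matrix m m ℂ} {L : Matrix m m ℂ →ₗ[ℂ] Matrix m m ℂ}
    (h : ∀ (t : ℝ) (y : Matrix m m ℂ),
      L (NormedSpace.exp ((t : ℂ) • x) * y * NormedSpace.exp ((t : ℂ) • -x))
        = NormedSpace.exp ((t : ℂ) • x) * L y * NormedSpace.exp ((t : ℂ) • -x))
    (y : Matrix m m ℂ) :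
    L (x * y - y * x) = x * L y - L y * x :=
  map_commutator_of_exp_conj (L := LinearMap.toContinuousLinearMap L) h y

/-- The matrices preserving `W` form a subalgebra, closed because it is finite-dimensional, so it is
stable under limits of the exponential series. -/
theorem matrix_exp_mulVec_mem {W : Submodule ℂ (m → ℂ)} {x : Matrix m m ℂ}
    (h : ∀ w ∈ W, x *ᵥ w ∈ W) : ∀ w ∈ W, NormedSpace.exp x *ᵥ w ∈ W := by
  let s : Subalgebra ℂ (Matrix m m ℂ) :=
    { carrier := {y | ∀ w ∈ W, y *ᵥ w ∈ W}
      mul_mem' := fun {a b} ha hb w hw => by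
        rw [← Matrix.mulVec_mulVec]; exact ha _ (hb _ hw)
      add_mem' := fun {a b} ha hb w hw => by
        rw [Matrix.add_mulVec]; exact W.add_mem (ha _ hw) (hb _ hw)
      algebraMap_mem' := fun r w hw => by
        rw [Algebra.algebraMap_eq_smul_one, Matrix.smul_mulVec, Matrix.one_mulVec]
        exact W.smul_mem _ hw }
  have hs : IsClosed (s : Set (Matrix m m ℂ)) :=
    (Submodule.closed_of_finiteDimensional (Subalgebra.toSubmodule s))
  exact NormedSpace.exp_mem hs (x := x) h

end MatrixExponential

/-! ### SU(2) as rotations about axes. -/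

section SpecialUnitary

/-- The traceless Hermitian matrix `n · σ`. -/
noncomputable def pauliDot (n : Fin 3 → ℝ) : Op 2 := ∑ k, (n k : ℂ) • pauli k

theorem pauliDot_eq (n : Fin 3 → ℝ) :
    pauliDot n = !![(n 2 : ℂ), n 0 - n 1 * Complex.I; n 0 + n 1 * Complex.I, -n 2] := by
  ext i j
  fin_cases i <;> fin_cases j <;> simp [pauliDot, pauli, Fin.sum_univ_three] <;> ring

theorem pauliDot_mul_self {n : Fin 3 → ℝ} (hn : ∑ k, n k ^ 2 = 1) :
    pauliDot n * pauliDot n = 1 := by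
  have h : (n 0 : ℂ) ^ 2 + n 1 ^ 2 + n 2 ^ 2 = 1 := by
    rw [Fin.sum_univ_three] at hn
    exact_mod_cast hn
  rw [pauliDot_eq]
  ext i j
  fin_cases i <;> fin_cases j <;> simp [Matrix.mul_apply] <;>
    first | ring1 | linear_combination h - (n 1 : ℂ) ^ 2 * Complex.I_sq

/-- The matrix `cos θ + i sin θ (n · σ)`. -/
noncomputable def rotationMatrix (n : Fin 3 → ℝ) (θ : ℝ) : Op 2 :=
  (Real.cos θ : ℂ) • (1 : Op 2) + (Real.sin θ : ℂ) • (Complex.I • pauliDot n)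

theorem rotationMatrix_eq (n : Fin 3 → ℝ) (θ : ℝ) :
    rotationMatrix n θ =
      !![(Real.cos θ : ℂ) + Real.sin θ * n 2 * Complex.I,
        Real.sin θ * n 1 + Real.sin θ * n 0 * Complex.I;
        -(Real.sin θ * n 1) + Real.sin θ * n 0 * Complex.I,
        Real.cos θ - Real.sin θ * n 2 * Complex.I] := by
  rw [rotationMatrix, pauliDot_eq]
  ext i j
  fin_cases i <;> fin_cases j <;> simp <;> ring_nf <;> simp <;> ring

theorem rotationMatrix_eq_exp {n : Fin 3 → ℝ} (hn : ∑ k, n k ^ 2 = 1) (θ : ℝ) :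
    rotationMatrix n θ = NormedSpace.exp ((θ : ℂ) • (Complex.I • pauliDot n)) := by
  rw [matrix_exp_real_smul_of_mul_self_eq_neg_one]
  · rfl
  · rw [smul_mul_smul_comm, pauliDot_mul_self hn, Complex.I_mul_I, neg_one_smul]

theorem rotationMatrix_mem {n : Fin 3 → ℝ} (hn : ∑ k, n k ^ 2 = 1) (θ : ℝ) :
    rotationMatrix n θ ∈ Matrix.specialUnitaryGroup (Fin 2) ℂ := by
  have h : (n 0 : ℂ) ^ 2 + n 1 ^ 2 + n 2 ^ 2 = 1 := by
    rw [Fin.sum_univ_three] at hn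
    exact_mod_cast hn
  have h2 : (Real.cos θ : ℂ) ^ 2 + (Real.sin θ : ℂ) ^ 2 = 1 := by
    exact_mod_cast Real.cos_sq_add_sin_sq θ
  rw [Matrix.mem_specialUnitaryGroup_iff, Matrix.mem_unitaryGroup_iff, rotationMatrix_eq]
  constructor
  · ext i j
    fin_cases i <;> fin_cases j <;> simp [Matrix.mul_apply, Matrix.star_apply,
      -Complex.ofReal_cos, -Complex.ofReal_sin] <;>
    first | ring1 | linear_combination h2 + (Real.sin θ : ℂ) ^ 2 * h -
      (Real.sin θ : ℂ) ^ 2 * ((n 0 : ℂ) ^ 2 + (n 2 : ℂ) ^ 2) * Complex.I_sq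
  · simp [Matrix.det_fin_two, -Complex.ofReal_cos, -Complex.ofReal_sin]
    linear_combination h2 + (Real.sin θ : ℂ) ^ 2 * h -
      (Real.sin θ : ℂ) ^ 2 * ((n 0 : ℂ) ^ 2 + (n 2 : ℂ) ^ 2) * Complex.I_sq

/-- For a unitary of determinant one the adjoint is the adjugate, so the rows are (a, b) and (−b̄,
ā) with |a|² + |b|² = 1. This is a unit quaternion: Re a is the cosine, and the other three real
coordinates are the sine times the axis. -/
theorem exists_eq_rotationMatrix (h : SU2) :
    ∃ (n : Fin 3 → ℝ) (θ : ℝ), ∑ k, n k ^ 2 = 1 ∧ (h : Op 2) = rotationMatrix n θ := by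
  obtain ⟨g, hg⟩ := h
  rw [Matrix.mem_specialUnitaryGroup_iff, Matrix.mem_unitaryGroup_iff] at hg
  obtain ⟨hu, hdet⟩ := hg
  have hadj : star g = g.adjugate := by
    have h1 : g * g.adjugate = 1 := by rw [Matrix.mul_adjugate, hdet, one_smul]
    have h2 : g.adjugate * g = 1 := by rw [Matrix.adjugate_mul, hdet, one_smul]
    calc star g = (g.adjugate * g) * star g := by rw [h2, one_mul]
      _ = g.adjugate := by rw [mul_assoc, hu, mul_one]
  rw [Matrix.adjugate_fin_two] at hadj
  have h11 : g 1 1 = star (g 0 0) := by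
    have := congrFun (congrFun hadj 0) 0
    simpa [Matrix.star_apply] using this.symm
  have h10 : g 1 0 = -star (g 0 1) := by
    have := congrFun (congrFun hadj 1) 0
    simp [Matrix.star_apply] at this
    simp [this]
  rw [Matrix.det_fin_two, h11, h10] at hdet
  set a := g 0 0 with ha
  set b := g 0 1 with hb
  have hnorm : a.re ^ 2 + (a.im ^ 2 + b.re ^ 2 + b.im ^ 2) = 1 := by
    have := congrArg Complex.re hdet
    simp at this
    linarith
  set r := Real.sqrt (a.im ^ 2 + b.re ^ 2 + b.im ^ 2) with hr
  have hr2 : r ^ 2 = a.im ^ 2 + b.re ^ 2 + b.im ^ 2 := Real.sq_sqrt (by positivity)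
  obtain ⟨n, hn, h0, h1, h2⟩ : ∃ n : Fin 3 → ℝ, ∑ k, n k ^ 2 = 1 ∧ r * n 0 = b.im ∧
      r * n 1 = b.re ∧ r * n 2 = a.im := by
    by_cases h : r = 0
    · rw [h] at hr2
      -- When the sine vanishes no axis is determined; the third one is an arbitrary choice.
      refine ⟨![0, 0, 1], by simp [Fin.sum_univ_three], ?_, ?_, ?_⟩ <;> simp [h] <;> nlinarith
    · refine ⟨![b.im / r, b.re / r, a.im / r], ?_, ?_, ?_, ?_⟩
      · simp [Fin.sum_univ_three]
        field_simp
        linarith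
      all_goals simp; field_simp
  have hcos : Real.cos (Real.arccos a.re) = a.re :=
    Real.cos_arccos (by nlinarith) (by nlinarith)
  have hsin : Real.sin (Real.arccos a.re) = r := by
    rw [Real.sin_arccos, hr]
    congr 1
    linarith
  refine ⟨n, Real.arccos a.re, hn, ?_⟩
  rw [rotationMatrix_eq, hcos, hsin]
  simp only [← Complex.ofReal_mul, h0, h1, h2]
  ext i j
  fin_cases i <;> fin_cases j <;>
    simp [h11, h10, ← ha, ← hb, Complex.ext_iff]

/-- The rotation about the unit vector `n` as an element of `SU(2)`. -/
noncomputable def rotation (n : Fin 3 → ℝ) (hn : ∑ k, n k ^ 2 = 1) (θ : ℝ) : SU2 :=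
  ⟨rotationMatrix n θ, rotationMatrix_mem hn θ⟩

theorem pauliDot_single (k : Fin 3) : pauliDot (Pi.single k 1) = pauli k := by
  simp [pauliDot, Pi.single_apply]

theorem pauli_mul_self (a : Fin 3) : pauli a * pauli a = 1 := by
  fin_cases a <;> ext i j <;> fin_cases i <;> fin_cases j <;> simp [pauli, Matrix.mul_apply]

theorem pauli_mul_pauli (a : Fin 3) : pauli a * pauli (a + 1) = Complex.I • pauli (a + 2) := by
  fin_cases a <;> ext i j <;> fin_cases i <;> fin_cases j <;> simp [pauli, Matrix.mul_apply]

theorem pauli_mul_pauli' (a : Fin 3) :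
    pauli (a + 1) * pauli a = -(Complex.I • pauli (a + 2)) := by
  fin_cases a <;> ext i j <;> fin_cases i <;> fin_cases j <;> simp [pauli, Matrix.mul_apply]

/-- The image of the `(a + 1)`-st coordinate vector under the rotation by `s` about the axis `a`. -/
noncomputable def rotatedAxis (a : Fin 3) (s : ℝ) : Fin 3 → ℝ :=
  Real.cos s • Pi.single (a + 1) 1 - Real.sin s • Pi.single (a + 2) 1

theorem sum_rotatedAxis_smul {M : Type*} [AddCommGroup M] [Module ℂ M] (a : Fin 3) (s : ℝ)
    (x : Fin 3 → M) :
    ∑ k, (rotatedAxis a s k : ℂ) • x k =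
      (Real.cos s : ℂ) • x (a + 1) - (Real.sin s : ℂ) • x (a + 2) := by
  simp [rotatedAxis, Pi.single_apply, sub_smul, ite_smul, -Complex.ofReal_cos,
    -Complex.ofReal_sin, Finset.sum_sub_distrib]

theorem sum_rotatedAxis_sq (a : Fin 3) (s : ℝ) : ∑ k, rotatedAxis a s k ^ 2 = 1 := by
  fin_cases a <;> simp [rotatedAxis, Fin.sum_univ_three, Pi.single_apply]

theorem sum_single_sq (a : Fin 3) : ∑ k, (Pi.single a 1 : Fin 3 → ℝ) k ^ 2 = 1 := by
  simp [Pi.single_apply]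

/-- Conjugation rotates by twice the angle of the quaternion, hence `s / 2`. The relations among the
three Pauli matrices, cyclic in `Fin 3`, reduce the identity to polynomials in sines and cosines. -/
theorem rotationMatrix_conj (a : Fin 3) (s t : ℝ) :
    rotationMatrix (Pi.single a 1) (s / 2) * rotationMatrix (Pi.single (a + 1) 1) t *
      rotationMatrix (Pi.single a 1) (-s / 2) = rotationMatrix (rotatedAxis a s) t := by
  have h1 := pauli_mul_self a
  have h2 := pauli_mul_pauli a
  have h3 := pauli_mul_pauli' a
  have hd : pauliDot (rotatedAxis a s) = _ := sum_rotatedAxis_smul a s pauli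
  have hc : (Real.cos s : ℂ) = (Real.cos (s / 2) : ℂ) ^ 2 - (Real.sin (s / 2) : ℂ) ^ 2 := by
    have := Real.cos_two_mul' (s / 2)
    rw [mul_div_cancel₀ _ (two_ne_zero)] at this
    exact_mod_cast this
  have hs : (Real.sin s : ℂ) = 2 * (Real.sin (s / 2) : ℂ) * (Real.cos (s / 2) : ℂ) := by
    have := Real.sin_two_mul (s / 2)
    rw [mul_div_cancel₀ _ (two_ne_zero)] at this
    exact_mod_cast this
  have h1' : (Real.cos (s / 2) : ℂ) ^ 2 + (Real.sin (s / 2) : ℂ) ^ 2 = 1 := by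
    exact_mod_cast Real.cos_sq_add_sin_sq (s / 2)
  simp only [rotationMatrix, hd, pauliDot_single, hc, hs, neg_div, Real.cos_neg,
    Real.sin_neg, Complex.ofReal_neg]
  generalize (Real.cos (s / 2) : ℂ) = c at *
  generalize (Real.sin (s / 2) : ℂ) = σ at *
  generalize (Real.cos t : ℂ) = c' at *
  generalize (Real.sin t : ℂ) = σ' at *
  generalize pauli a = A at *
  generalize pauli (a + 1) = B at *
  generalize pauli (a + 2) = C at *
  have h4 : A * B * A = -B := by
    rw [h2, smul_mul_assoc, ← smul_mul_assoc, ← neg_neg (Complex.I • C), ← h3, neg_mul, mul_assoc,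
      h1, mul_one]
  have h5 : C * A = Complex.I • B := by
    rw [h2, smul_mul_assoc] at h4
    rw [← neg_neg B, ← h4, smul_neg, smul_smul, Complex.I_mul_I, neg_one_smul, neg_neg]
  simp only [mul_add, add_mul, smul_mul_assoc, mul_smul_comm, mul_one, one_mul, h1, h2, h3, h5,
    smul_smul, smul_neg, smul_sub]
  match_scalars
  · linear_combination c' * h1' - σ ^ 2 * c' * Complex.I_sq
  · ring
  · linear_combination -σ' * σ ^ 2 * Complex.I * (Complex.I ^ 2 - 1) * Complex.I_sq
  · linear_combination 2 * σ' * σ * c * Complex.I * Complex.I_sq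

end SpecialUnitary

/-! ### From the group representation to its Lie algebra. -/

section Generators

variable {d : ℕ} {U : SU2 →* Matrix.unitaryGroup (Fin d) ℂ} {J : Fin 3 → Op d}

theorem IsSpinIrrep.apply_rotation (h : IsSpinIrrep U J) {n : Fin 3 → ℝ} (hn : ∑ k, n k ^ 2 = 1)
    (θ : ℝ) : (U (rotation n hn θ) : Op d) =
      NormedSpace.exp (((2 * θ : ℝ) : ℂ) • (Complex.I • ∑ k, (n k : ℂ) • J k)) := by
  rw [h.generates (fun k => 2 * θ * n k)]
  · congr 1
    simp only [Finset.smul_sum, smul_smul]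
    refine Finset.sum_congr rfl fun k _ => ?_
    congr 1
    push_cast
    ring
  · change rotationMatrix n θ = _
    rw [rotationMatrix_eq_exp hn, pauliDot]
    congr 1
    simp only [Finset.smul_sum, smul_smul]
    refine Finset.sum_congr rfl fun k _ => ?_
    congr 1
    push_cast
    ring

theorem IsSpinIrrep.apply_rotation_single (h : IsSpinIrrep U J) (k : Fin 3) (θ : ℝ) :
    (U (rotation (Pi.single k 1) (sum_single_sq k) (θ / 2)) : Op d) =
      NormedSpace.exp ((θ : ℂ) • (Complex.I • J k)) := by
  rw [h.apply_rotation, mul_div_cancel₀ _ (two_ne_zero)]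
  simp [Pi.single_apply]

/-- `U` transports `rotationMatrix_conj` to the hypothesis of `matrix_commutator_eq_of_exp_conj`.
The minus sign in `z` is the one in `rotatedAxis`; two factors of i then turn it into the usual
relation. -/
theorem IsSpinIrrep.commutator (h : IsSpinIrrep U J) (a : Fin 3) :
    J a * J (a + 1) - J (a + 1) * J a = Complex.I • J (a + 2) := by
  have key := matrix_commutator_eq_of_exp_conj (x := Complex.I • J a)
    (y := Complex.I • J (a + 1)) (z := -(Complex.I • J (a + 2))) (fun s t => by
      have h1 : rotation (Pi.single a 1) (sum_single_sq a) (s / 2) *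
          rotation (Pi.single (a + 1) 1) (sum_single_sq (a + 1)) (t / 2) *
          rotation (Pi.single a 1) (sum_single_sq a) (-s / 2) =
          rotation (rotatedAxis a s) (sum_rotatedAxis_sq a s) (t / 2) :=
        Subtype.ext (rotationMatrix_conj a s (t / 2))
      have h2 := congrArg (fun g => (U g : Op d)) h1
      simp only [map_mul, Submonoid.coe_mul] at h2
      rw [h.apply_rotation_single, h.apply_rotation_single, h.apply_rotation_single,
        h.apply_rotation, mul_div_cancel₀ _ (two_ne_zero), sum_rotatedAxis_smul] at h2
      convert! h2 using 2
      · simp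
      · simp [smul_comm Complex.I, sub_eq_add_neg])
  have h3 : -(J a * J (a + 1) - J (a + 1) * J a) = -(Complex.I • J (a + 2)) := by
    rw [← key, smul_mul_smul_comm, smul_mul_smul_comm, ← smul_sub, Complex.I_mul_I, neg_one_smul]
  exact neg_injective h3

theorem IsSpinIrrep.irreducible_of_generators (h : IsSpinIrrep U J)
    (W : Submodule ℂ (Fin d → ℂ)) (hW : ∀ k, ∀ w ∈ W, J k *ᵥ w ∈ W) : W = ⊥ ∨ W = ⊤ := by
  refine h.irreducible W fun g => ?_
  obtain ⟨n, θ, hn, hg⟩ := exists_eq_rotationMatrix g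
  have : g = rotation n hn θ := Subtype.ext hg
  rw [this, h.apply_rotation hn]
  refine matrix_exp_mulVec_mem fun w hw => ?_
  simp only [Matrix.smul_mulVec, Matrix.sum_mulVec]
  exact W.smul_mem _ (W.smul_mem _ (W.sum_mem fun k _ => W.smul_mem _ (hW k w hw)))

theorem IsCovariant.map_commutator (h : IsSpinIrrep U J) {E : Op d →ₗ[ℂ] Op d}
    (hE : IsCovariant U E) (k : Fin 3) (X : Op d) :
    E (J k * X - X * J k) = J k * E X - E X * J k := by
  have key := matrix_map_commutator_of_exp_conj (x := Complex.I • J k) (L := E) (fun t y => by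
    have h1 := hE (rotation (Pi.single k 1) (sum_single_sq k) (t / 2)) y
    set V := U (rotation (Pi.single k 1) (sum_single_sq k) (t / 2)) with hV
    have h2 : (V : Op d) = NormedSpace.exp ((t : ℂ) • (Complex.I • J k)) :=
      h.apply_rotation_single k t
    have h3 : (V : Op d)ᴴ = NormedSpace.exp ((t : ℂ) • -(Complex.I • J k)) := by
      rw [h2, ← Matrix.exp_conjTranspose]
      simp [Matrix.conjTranspose_smul, (h.hermitian k).eq]
    have h4 : (V : Op d) * (V : Op d)ᴴ = 1 := Matrix.mem_unitaryGroup_iff.mp V.2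
    rw [← h2, ← h3, ← h1]
    simp only [← mul_assoc, h4, one_mul]
    rw [mul_assoc _ (V : Op d), h4, mul_one]) X
  simp only [smul_mul_assoc, mul_smul_comm, ← smul_sub, map_smul] at key
  exact smul_right_injective _ Complex.I_ne_zero key

end Generators

/-! ### Ladder operators and the weight basis of ℂ^d. -/

section Ladder

variable {V : Type*} [AddCommGroup V] [Module ℂ V]

theorem ladder_pow_apply {Z P : Module.End ℂ V} {c μ : ℂ} (h : Z * P - P * Z = c • P) {x : V}
    (hx : Z x = μ • x) (n : ℕ) : Z ((P ^ n) x) = (μ + n * c) • (P ^ n) x := by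
  induction n with
  | zero => simpa using hx
  | succ n ih =>
    have h1 : Z * P = P * Z + c • P := by rw [← h]; abel
    have h2 := LinearMap.congr_fun h1 ((P ^ n) x)
    simp only [Module.End.mul_apply, LinearMap.add_apply, LinearMap.smul_apply, ih,
      map_smul] at h2
    rw [pow_succ', Module.End.mul_apply, h2, ← add_smul]
    push_cast
    congr 1
    ring

/-- A ladder operator eventually annihilates every eigenvector. -/
theorem exists_ladder_top [FiniteDimensional ℂ V] {Z P : Module.End ℂ V} {c μ : ℂ} (hc : c ≠ 0)
    (h : Z * P - P * Z = c • P) {x : V} (hx : Z x = μ • x) (hx0 : x ≠ 0) :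
    ∃ n, (P ^ n) x ≠ 0 ∧ P ((P ^ n) x) = 0 := by
  by_contra! hcon
  have hne : ∀ n, (P ^ n) x ≠ 0 := by
    intro n
    induction n with
    | zero => simpa using hx0
    | succ n ih => rw [pow_succ', Module.End.mul_apply]; exact hcon n ih
  have hev : ∀ n : ℕ, Z.HasEigenvalue (μ + n * c) := fun n =>
    Module.End.hasEigenvalue_of_hasEigenvector
      ⟨Module.End.mem_eigenspace_iff.mpr (ladder_pow_apply h hx n), hne n⟩
  have hinj : Function.Injective fun n : ℕ => μ + n * c := fun a b hab => by
    simpa [hc] using hab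
  exact Set.infinite_of_injective_forall_mem hinj hev (Module.End.finite_hasEigenvalue Z)

/-- A nonzero subspace that is stable under `Z` and a ladder operator contains an eigenvector of
`Z` annihilated by the ladder operator. -/
theorem exists_ladder_top_mem [FiniteDimensional ℂ V] {Z P : Module.End ℂ V} {c : ℂ} (hc : c ≠ 0)
    (h : Z * P - P * Z = c • P) {W : Submodule ℂ V} (hW : W ≠ ⊥) (hZ : ∀ x ∈ W, Z x ∈ W)
    (hP : ∀ x ∈ W, P x ∈ W) : ∃ x ∈ W, x ≠ 0 ∧ P x = 0 ∧ ∃ μ : ℂ, Z x = μ • x := by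
  have : Nontrivial W := Submodule.nontrivial_iff_ne_bot.mpr hW
  obtain ⟨μ, hμ⟩ := Module.End.exists_eigenvalue (Z.restrict hZ)
  obtain ⟨x, hx, hx0⟩ := hμ.exists_hasEigenvector
  have hx' : Z x = μ • (x : V) := congrArg Subtype.val (Module.End.mem_eigenspace_iff.mp hx)
  obtain ⟨n, hn, hn'⟩ := exists_ladder_top hc h hx' (by simpa using hx0)
  refine ⟨(P ^ n) x, ?_, hn, hn', _, ladder_pow_apply h hx' n⟩
  clear hn hn'
  induction n with
  | zero => simp
  | succ n ih => rw [pow_succ', Module.End.mul_apply]; exact hP _ ih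

end Ladder

/-- The infinitesimal form of a spin representation: irreducible Hermitian angular momentum
operators. -/
structure IsAngularMomentum {d : ℕ} (J : Fin 3 → Op d) : Prop where
  hermitian : ∀ k, (J k).IsHermitian
  commutator : ∀ a, J a * J (a + 1) - J (a + 1) * J a = Complex.I • J (a + 2)
  irreducible : ∀ W : Submodule ℂ (Fin d → ℂ), (∀ k, ∀ w ∈ W, J k *ᵥ w ∈ W) → W = ⊥ ∨ W = ⊤

theorem IsSpinIrrep.isAngularMomentum {d : ℕ} {U : SU2 →* Matrix.unitaryGroup (Fin d) ℂ}
    {J : Fin 3 → Op d} (h : IsSpinIrrep U J) : IsAngularMomentum J :=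
  ⟨h.hermitian, h.commutator, h.irreducible_of_generators⟩

/-- The raising operator `J₊`. -/
noncomputable def raising {d : ℕ} (J : Fin 3 → Op d) : Op d := J 0 + Complex.I • J 1

/-- The lowering operator `J₋`. -/
noncomputable def lowering {d : ℕ} (J : Fin 3 → Op d) : Op d := J 0 - Complex.I • J 1

theorem angularMomentum_zero_eq {d : ℕ} (J : Fin 3 → Op d) : J 0 = (1 / 2 : ℂ) • (raising J + lowering J) := by
  simp only [raising, lowering]; module

theorem angularMomentum_one_eq {d : ℕ} (J : Fin 3 → Op d) :
    J 1 = (-Complex.I / 2) • (raising J - lowering J) := by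
  rw [raising, lowering, add_sub_sub_cancel, ← two_smul ℂ, smul_smul, smul_smul]
  have : -Complex.I / 2 * (2 * Complex.I) = 1 := by linear_combination -Complex.I_sq
  rw [mul_assoc, this, one_smul]

namespace IsAngularMomentum

variable {d : ℕ} {J : Fin 3 → Op d}

theorem conjTranspose_raising (h : IsAngularMomentum J) : (raising J)ᴴ = lowering J := by
  simp [raising, lowering, (h.hermitian _).eq, sub_eq_add_neg]

theorem commutator_raising (h : IsAngularMomentum J) :
    J 2 * raising J - raising J * J 2 = raising J := by
  have h1 := h.commutator 1
  have h2 := h.commutator 2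
  simp only [Fin.isValue, Fin.reduceAdd] at h1 h2
  have h3 : J 2 * raising J - raising J * J 2 =
      (J 2 * J 0 - J 0 * J 2) - Complex.I • (J 1 * J 2 - J 2 * J 1) := by
    simp only [raising, mul_add, add_mul, mul_smul_comm, smul_mul_assoc]; module
  rw [h3, h1, h2, smul_smul, Complex.I_mul_I, raising]
  module

theorem commutator_lowering (h : IsAngularMomentum J) :
    J 2 * lowering J - lowering J * J 2 = -lowering J := by
  have h1 := congrArg Matrix.conjTranspose h.commutator_raising
  simp only [Matrix.conjTranspose_sub, Matrix.conjTranspose_mul, h.conjTranspose_raising,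
    (h.hermitian _).eq] at h1
  rw [← neg_sub, h1]

theorem commutator_raising_lowering (h : IsAngularMomentum J) :
    raising J * lowering J - lowering J * raising J = (2 : ℂ) • J 2 := by
  have h1 := h.commutator 0
  simp only [Fin.isValue, Fin.reduceAdd] at h1
  have h3 : raising J * lowering J - lowering J * raising J =
      (-2 * Complex.I) • (J 0 * J 1 - J 1 * J 0) := by
    simp only [raising, lowering, mul_add, add_mul, mul_sub, sub_mul, mul_smul_comm,
      smul_mul_assoc]; module
  rw [h3, h1, smul_smul, mul_assoc, Complex.I_mul_I]
  norm_num

theorem sum_sq_eq (h : IsAngularMomentum J) :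
    ∑ k, J k * J k = raising J * lowering J + J 2 * J 2 - J 2 := by
  have h1 := h.commutator 0
  simp only [Fin.isValue, Fin.reduceAdd] at h1
  have h2 : J 2 = (-Complex.I) • (J 0 * J 1 - J 1 * J 0) := by
    rw [h1, smul_smul]; simp
  have h3 : raising J * lowering J = J 0 * J 0 + J 1 * J 1 +
      (-Complex.I) • (J 0 * J 1 - J 1 * J 0) := by
    simp only [raising, lowering, mul_add, add_mul, mul_sub, sub_mul, mul_smul_comm,
      smul_mul_assoc, smul_smul, smul_sub, smul_add, Complex.I_mul_I]; module
  rw [h3, ← h2, Fin.sum_univ_three]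
  abel

end IsAngularMomentum

/-- `w` is a lowest weight vector generating `ℂ^d` under the raising operator. -/
structure IsLowestWeight {d : ℕ} (J : Fin 3 → Op d) (w : Fin d → ℂ) : Prop where
  weight : ∀ n : ℕ, J 2 *ᵥ (raising J ^ n *ᵥ w) =
    ((n : ℂ) - ((d : ℂ) - 1) / 2) • (raising J ^ n *ᵥ w)
  lowering_eq_zero : lowering J *ᵥ w = 0
  ne_zero : ∀ n < d, raising J ^ n *ᵥ w ≠ 0
  linearIndependent : LinearIndependent ℂ fun n : Fin d => raising J ^ (n : ℕ) *ᵥ w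
  span_eq_top : Submodule.span ℂ (Set.range fun n : Fin d => raising J ^ (n : ℕ) *ᵥ w) = ⊤

theorem toLin'_commutator {d : ℕ} {X Y : Op d} {c : ℂ} (h : X * Y - Y * X = c • Y) :
    Matrix.toLin' X * Matrix.toLin' Y - Matrix.toLin' Y * Matrix.toLin' X =
      c • Matrix.toLin' Y := by
  rw [← map_smul, ← h, map_sub, Matrix.toLin'_mul, Matrix.toLin'_mul]; rfl

/-- Start from an eigenvector of J₂ killed by J₋, of weight μ, and raise it until the last nonzero
vector u_N. Moving J₋ past J₊ gives J₋ u_{n+1} = −(n + 1)(2μ + n) u_n; at n = N the left side is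
zero, so μ = −N/2. The span of the u_n is invariant, hence everything by irreducibility, and the
distinct weights make them independent, so N + 1 = d. -/
theorem IsAngularMomentum.exists_isLowestWeight {d : ℕ} [NeZero d] {J : Fin 3 → Op d}
    (h : IsAngularMomentum J) : ∃ w, IsLowestWeight J w := by
  set P := raising J with hP
  set M := lowering J with hM
  have : Nonempty (Fin d) := ⟨0⟩
  have hZM : Matrix.toLin' (J 2) * Matrix.toLin' M - Matrix.toLin' M * Matrix.toLin' (J 2) =
      (-1 : ℂ) • Matrix.toLin' M :=
    toLin'_commutator (by rw [neg_one_smul]; exact h.commutator_lowering)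
  have hZP : Matrix.toLin' (J 2) * Matrix.toLin' P - Matrix.toLin' P * Matrix.toLin' (J 2) =
      (1 : ℂ) • Matrix.toLin' P :=
    toLin'_commutator (by rw [one_smul]; exact h.commutator_raising)
  obtain ⟨w, -, hw0, hMw, μ, hw⟩ := exists_ladder_top_mem (W := ⊤) (by norm_num) hZM
    top_ne_bot (fun _ _ => trivial) (fun _ _ => trivial)
  obtain ⟨N, hN, hN'⟩ := exists_ladder_top one_ne_zero hZP hw hw0
  have hwt := ladder_pow_apply hZP hw
  simp only [← Matrix.toLin'_pow, Matrix.toLin'_apply, mul_one] at hMw hw hN hN' hwt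
  set u : ℕ → Fin d → ℂ := fun n => P ^ n *ᵥ w with hu
  have hus : ∀ n, P *ᵥ u n = u (n + 1) := fun n => by
    simp only [hu]; rw [Matrix.mulVec_mulVec, pow_succ']
  have hlow : ∀ n : ℕ, M *ᵥ u (n + 1) = (-(((n : ℂ) + 1) * (2 * μ + n))) • u n := by
    have hcomm : ∀ x, M *ᵥ (P *ᵥ x) = P *ᵥ (M *ᵥ x) - (2 : ℂ) • (J 2 *ᵥ x) := fun x => by
      rw [← Matrix.smul_mulVec, ← h.commutator_raising_lowering, Matrix.sub_mulVec,
        Matrix.mulVec_mulVec, Matrix.mulVec_mulVec, sub_sub_cancel]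
    intro n
    induction n with
    | zero =>
      rw [← hus, hcomm]
      have : u 0 = w := by simp [hu]
      rw [this, hMw, hw]
      simp [smul_smul]
    | succ n ih =>
      rw [← hus (n + 1), hcomm, ih, Matrix.mulVec_smul, hus, hwt, smul_smul, ← sub_smul]
      congr 1
      push_cast
      ring
  have hzero : ∀ k, u (N + 1 + k) = 0 := by
    intro k
    induction k with
    | zero => rw [add_zero, ← hus]; exact hN'
    | succ k ih => rw [← add_assoc, ← hus, ih, Matrix.mulVec_zero]
  have hne : ∀ n ≤ N, u n ≠ 0 := by
    intro n hn h0
    obtain ⟨k, rfl⟩ := Nat.exists_eq_add_of_le hn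
    apply hN
    change u (n + k) = 0
    clear hn hN hN' hzero
    induction k with
    | zero => simpa using h0
    | succ k ih => rw [← add_assoc, ← hus, ih, Matrix.mulVec_zero]
  have hμ : μ = -(N : ℂ) / 2 := by
    have h1 := hlow N
    rw [← add_zero (N + 1), hzero 0, Matrix.mulVec_zero, eq_comm, smul_eq_zero] at h1
    have h2 := h1.resolve_right hN
    have h3 : (N : ℂ) + 1 ≠ 0 := by exact_mod_cast N.succ_ne_zero
    have h4 := (mul_eq_zero.mp (neg_eq_zero.mp h2)).resolve_left h3
    linear_combination h4 / 2
  have hspan : Submodule.span ℂ (Set.range fun n : Fin (N + 1) => u n) = ⊤ := by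
    set W := Submodule.span ℂ (Set.range fun n : Fin (N + 1) => u n) with hW
    have hmem : ∀ n, u n ∈ W := by
      intro n
      rcases lt_or_ge n (N + 1) with hn | hn
      · exact Submodule.subset_span ⟨⟨n, hn⟩, rfl⟩
      · obtain ⟨k, rfl⟩ := Nat.exists_eq_add_of_le hn
        rw [hzero]; exact W.zero_mem
    have hinv : ∀ X : Op d, (∀ n, X *ᵥ u n ∈ W) → ∀ x ∈ W, X *ᵥ x ∈ W := by
      intro X hX x hx
      have : W ≤ W.comap (Matrix.toLin' X) := by
        rw [hW, Submodule.span_le]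
        rintro _ ⟨n, rfl⟩
        exact hX n
      exact this hx
    have hPW := hinv P fun n => by rw [hus]; exact hmem _
    have hZW := hinv (J 2) fun n => by rw [hwt]; exact W.smul_mem _ (hmem _)
    have hMW := hinv M fun n => by
      cases n with
      | zero => simp [hu, hMw]
      | succ n => rw [hlow]; exact W.smul_mem _ (hmem _)
    refine (h.irreducible W fun k x hx => ?_).resolve_left fun hbot => ?_
    · fin_cases k
      · change J 0 *ᵥ x ∈ W
        rw [angularMomentum_zero_eq J, Matrix.smul_mulVec, Matrix.add_mulVec]
        exact W.smul_mem _ (W.add_mem (hPW x hx) (hMW x hx))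
      · change J 1 *ᵥ x ∈ W
        rw [angularMomentum_one_eq J, Matrix.smul_mulVec, Matrix.sub_mulVec]
        exact W.smul_mem _ (W.sub_mem (hPW x hx) (hMW x hx))
      · exact hZW x hx
    · have := hmem 0
      rw [hbot, Submodule.mem_bot] at this
      exact hne 0 (Nat.zero_le _) this
  have hli : LinearIndependent ℂ fun n : Fin (N + 1) => u n := by
    refine Module.End.eigenvectors_linearIndependent' (Matrix.toLin' (J 2))
      (fun n : Fin (N + 1) => μ + (n : ℕ)) (fun a b hab => ?_) _ fun n =>
        ⟨Module.End.mem_eigenspace_iff.mpr (hwt n), hne n (by omega)⟩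
    simpa [Fin.ext_iff] using hab
  have hd : N + 1 = d := by
    have := Module.finrank_eq_card_basis (Module.Basis.mk hli hspan.ge)
    simpa using this.symm
  subst hd
  refine ⟨w, fun n => ?_, hMw, fun n hn => hne n (by omega), hli, hspan⟩
  rw [← hP, hwt n, hμ]
  congr 1
  push_cast
  ring

namespace IsLowestWeight

variable {d : ℕ} {J : Fin 3 → Op d} {w : Fin d → ℂ}

/-- An operator commuting with J₊ is determined by its value on `w`, because the raised vectors
span. -/
theorem eq_smul_pow_of_mulVec (hw : IsLowestWeight J w) {X : Op d} (hX : Commute (raising J) X)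
    {c : ℂ} {n : ℕ} (h : X *ᵥ w = c • (raising J ^ n *ᵥ w)) : X = c • raising J ^ n := by
  apply Matrix.toLin'.injective
  refine LinearMap.ext_on_range hw.span_eq_top fun k => ?_
  rw [Matrix.toLin'_apply, Matrix.toLin'_apply, Matrix.mulVec_mulVec, ← (hX.pow_left k).eq,
    ← Matrix.mulVec_mulVec, h, Matrix.mulVec_smul, Matrix.mulVec_mulVec, ← pow_add,
    Matrix.smul_mulVec, Matrix.mulVec_mulVec, ← pow_add, add_comm]

theorem exists_eq_of_eigenvector (hw : IsLowestWeight J w) {μ : ℂ} {x : Fin d → ℂ} (hx : x ≠ 0)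
    (h : J 2 *ᵥ x = μ • x) :
    ∃ n < d, μ = (n : ℂ) - ((d : ℂ) - 1) / 2 ∧ ∃ c : ℂ, x = c • (raising J ^ n *ᵥ w) := by
  set b := Module.Basis.mk hw.linearIndependent hw.span_eq_top.ge with hb
  have hbn : ∀ n, b n = raising J ^ (n : ℕ) *ᵥ w := fun n => by simp [hb]
  have hcoef : ∀ n, μ * b.repr x n = ((n : ℕ) - ((d : ℂ) - 1) / 2) * b.repr x n := by
    intro n
    have h1 : J 2 *ᵥ x = ∑ n : Fin d, (((n : ℕ) - ((d : ℂ) - 1) / 2) * b.repr x n) • b n := by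
      conv_lhs => rw [← b.sum_repr x]
      rw [Matrix.mulVec_sum]
      refine Finset.sum_congr rfl fun n _ => ?_
      rw [Matrix.mulVec_smul, hbn, hw.weight, smul_smul, mul_comm]
    have h2 := congrArg (fun y => b.repr y n) (h.symm.trans h1)
    simpa [Finsupp.single_apply] using h2
  obtain ⟨n, hn⟩ : ∃ n, b.repr x n ≠ 0 := by
    by_contra! hcon
    exact hx (b.repr.map_eq_zero_iff.mp (Finsupp.ext hcon))
  have hμ : μ = (n : ℕ) - ((d : ℂ) - 1) / 2 := mul_right_cancel₀ hn (hcoef n)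
  refine ⟨n, n.2, hμ, b.repr x n, ?_⟩
  conv_lhs => rw [← b.sum_repr x]
  rw [Finset.sum_eq_single n, hbn]
  · intro m _ hm
    have h1 := hcoef m
    rw [hμ, ← sub_eq_zero, ← sub_mul, mul_eq_zero] at h1
    rw [h1.resolve_left, zero_smul]
    intro h2
    apply hm
    have : (n : ℂ) = ((m : ℕ) : ℂ) := by linear_combination h2
    exact Fin.ext (by exact_mod_cast this.symm)
  · simp

/-- Highest weight vectors of the adjoint action are powers of the raising operator. -/
theorem exists_eq_smul_pow (hw : IsLowestWeight J w) {X : Op d} (hX0 : X ≠ 0)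
    (hX : raising J * X - X * raising J = 0) {μ : ℂ} (hμ : J 2 * X - X * J 2 = μ • X) :
    ∃ n < d, μ = n ∧ ∃ c : ℂ, X = c • raising J ^ n := by
  have hcomm : Commute (raising J) X := sub_eq_zero.mp hX
  have hx0 : X *ᵥ w ≠ 0 := fun h0 => hX0 <| by
    simpa using hw.eq_smul_pow_of_mulVec hcomm (c := 0) (n := 0) (by simpa using h0)
  -- `X` shifts weights by μ. Since all weight spaces are lines, `X w` must be a multiple of one
  -- raising power of `w`.
  have hx : J 2 *ᵥ (X *ᵥ w) = (μ - ((d : ℂ) - 1) / 2) • (X *ᵥ w) := by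
    have h0 := hw.weight 0
    simp only [pow_zero, Matrix.one_mulVec, Nat.cast_zero, zero_sub] at h0
    have h1 : J 2 * X = μ • X + X * J 2 := by rw [← hμ]; abel
    rw [Matrix.mulVec_mulVec, h1, Matrix.add_mulVec, ← Matrix.mulVec_mulVec, h0,
      Matrix.mulVec_smul, Matrix.smul_mulVec]
    module
  obtain ⟨n, hn, hn', c, hc⟩ := hw.exists_eq_of_eigenvector hx0 hx
  exact ⟨n, hn, by linear_combination hn', c, hw.eq_smul_pow_of_mulVec hcomm hc⟩

theorem raising_pow_ne_zero (hw : IsLowestWeight J w) {n : ℕ} (hn : n < d) :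
    raising J ^ n ≠ 0 := fun h0 => hw.ne_zero n hn (by rw [h0, Matrix.zero_mulVec])

end IsLowestWeight

/-- The Casimir operator is `j (j + 1)` with `2 j + 1 = d`. -/
theorem IsAngularMomentum.sum_sq {d : ℕ} [NeZero d] {J : Fin 3 → Op d}
    (h : IsAngularMomentum J) : ∑ k, J k * J k = (((d : ℂ) ^ 2 - 1) / 4) • (1 : Op d) := by
  obtain ⟨w, hw⟩ := h.exists_isLowestWeight
  have hc : Commute (raising J) (∑ k, J k * J k) := by
    rw [h.sum_sq_eq, commute_iff_eq, ← sub_eq_zero]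
    have h1 := h.commutator_raising
    have h2 := h.commutator_raising_lowering
    generalize raising J = P at *
    generalize lowering J = M at *
    generalize J 2 = Z at *
    rw [two_smul] at h2
    have h3 : (P * M + Z * Z - Z) * P - P * (P * M + Z * Z - Z) =
        -(P * (P * M - M * P - (Z + Z))) + Z * (Z * P - P * Z - P) + (Z * P - P * Z - P) * Z := by
      noncomm_ring
    rw [← neg_sub, h3, h1, h2]
    simp
  -- J₋ kills `w`, so on `w` only m² − m remains, at m = −(d − 1)/2.
  have := hw.eq_smul_pow_of_mulVec hc (c := ((d : ℂ) ^ 2 - 1) / 4) (n := 0) (by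
    have h0 := hw.weight 0
    simp only [pow_zero, Matrix.one_mulVec, Nat.cast_zero, zero_sub] at h0
    rw [h.sum_sq_eq, Matrix.sub_mulVec, Matrix.add_mulVec, ← Matrix.mulVec_mulVec,
      ← Matrix.mulVec_mulVec, hw.lowering_eq_zero, h0, Matrix.mulVec_smul, h0]
    simp only [pow_zero, Matrix.one_mulVec, Matrix.mulVec_zero]
    match_scalars
    ring)
  simpa using this

/-! ### Positive operators and traces. -/

section InnerProduct

variable {V : Type*} [NormedAddCommGroup V] [InnerProductSpace ℂ V] [FiniteDimensional ℂ V]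

theorem isPositive_of_forall_eigenvalue {T : V →ₗ[ℂ] V} (hT : T.IsSymmetric)
    (h : ∀ (c : ℝ) (x : V), x ≠ 0 → T x = (c : ℂ) • x → 0 ≤ c) : T.IsPositive := by
  refine ⟨hT, fun x => ?_⟩
  set b := hT.eigenvectorBasis rfl
  rw [← b.sum_inner_mul_inner, map_sum]
  refine Finset.sum_nonneg fun i _ => ?_
  have h0 : 0 ≤ hT.eigenvalues rfl i :=
    h _ (b i) (b.orthonormal.ne_zero i) (hT.apply_eigenvectorBasis rfl i)
  have h1 := mul_nonneg h0 (mul_self_nonneg ‖inner ℂ x (b i)‖)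
  rw [hT, hT.apply_eigenvectorBasis, inner_smul_right, mul_assoc, ← inner_conj_symm (b i) x,
    RCLike.mul_conj]
  have h2 : ∀ a t : ℝ, RCLike.re ((a : ℂ) * (t : ℂ) ^ 2) = a * (t * t) := fun a t => by
    rw [← sq]
    exact_mod_cast Complex.ofReal_re _
  exact h1.trans_eq (h2 _ _).symm

/-- In an eigenbasis of `A` the trace is a sum of eigenvalues of `A` times diagonal entries of `B`.
The upper bound on tr C² and both bounds on tr (C casimir) are instances. -/
theorem re_trace_mul_nonneg {A B : V →ₗ[ℂ] V} (hA : A.IsPositive) (hB : B.IsPositive) :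
    0 ≤ (LinearMap.trace ℂ V (A * B)).re := by
  set b := hA.isSymmetric.eigenvectorBasis rfl
  rw [LinearMap.trace_eq_sum_inner _ b, Complex.re_sum]
  refine Finset.sum_nonneg fun i _ => ?_
  rw [Module.End.mul_apply, ← hA.isSymmetric, hA.isSymmetric.apply_eigenvectorBasis,
    inner_smul_left]
  have h1 := hA.nonneg_eigenvalues rfl i
  have h2 := hB.re_inner_nonneg_right (b i)
  simpa using mul_nonneg h1 h2

theorem re_trace_nonneg {A : V →ₗ[ℂ] V} (hA : A.IsPositive) :
    0 ≤ (LinearMap.trace ℂ V A).re := by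
  simpa using re_trace_mul_nonneg hA LinearMap.isPositive_one

theorem re_trace_sq_nonneg {A : V →ₗ[ℂ] V} (hA : A.IsSymmetric) :
    0 ≤ (LinearMap.trace ℂ V (A * A)).re := by
  set b := hA.eigenvectorBasis rfl
  rw [LinearMap.trace_eq_sum_inner _ b, Complex.re_sum]
  refine Finset.sum_nonneg fun i _ => ?_
  rw [Module.End.mul_apply, ← hA]
  exact inner_self_nonneg (𝕜 := ℂ)

theorem trace_mul_im_eq_zero {A B : V →ₗ[ℂ] V} (hA : A.IsSymmetric) (hB : B.IsSymmetric) :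
    (LinearMap.trace ℂ V (A * B)).im = 0 := by
  let b := hA.eigenvectorBasis rfl
  rw [LinearMap.trace_eq_sum_inner _ b, Complex.im_sum]
  refine Finset.sum_eq_zero fun i _ => ?_
  rw [Module.End.mul_apply, ← hA, show A (b i) = _ from hA.apply_eigenvectorBasis rfl i,
    inner_smul_left, ← hB]
  have h1 : (inner ℂ (B (b i)) (b i)).im = 0 := by
    rw [← Complex.conj_eq_iff_im, inner_conj_symm, hB]
  rw [Complex.mul_im, show (inner ℂ (B (hA.eigenvectorBasis rfl i)) (b i)).im = 0 from h1, mul_zero,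
    zero_add]
  simp

/-- An eigenvalue of a positive operator, multiplied by the number of orthogonal eigenvectors, is
bounded by the trace. -/
theorem card_mul_eigenvalue_le_trace {A : V →ₗ[ℂ] V} (hA : A.IsPositive) {ι : Type*} [Fintype ι]
    {c : ℝ} {x : ι → V} (hx : ∀ i, x i ≠ 0)
    (hxx : Pairwise fun i k => inner ℂ (x i) (x k) = 0) (h : ∀ i, A (x i) = (c : ℂ) • x i) :
    Fintype.card ι * c ≤ (LinearMap.trace ℂ V A).re := by
  classical
  set e : ι → V := fun i => ((‖x i‖⁻¹ : ℝ) : ℂ) • x i with he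
  have hnorm : ∀ i, ‖e i‖ = 1 := fun i => by
    simp [he, norm_smul, inv_mul_cancel₀ (norm_ne_zero_iff.mpr (hx i))]
  have ho : Orthonormal ℂ e :=
    ⟨hnorm, fun i k hik => by simp [he, inner_smul_left, inner_smul_right, hxx hik]⟩
  obtain ⟨u, b, hu, hb⟩ := ho.toSubtypeRange.exists_orthonormalBasis_extension
  have hsum : ∑ i : u, (inner ℂ (b i) (A (b i))).re = (LinearMap.trace ℂ V A).re := by
    rw [LinearMap.trace_eq_sum_inner _ b, Complex.re_sum]
  let f : ι → u := fun i => ⟨e i, hu ⟨i, rfl⟩⟩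
  have hf : Function.Injective f := fun i k hik =>
    ho.linearIndependent.injective (congrArg Subtype.val hik)
  have he' : ∀ i, (inner ℂ (b (f i)) (A (b (f i)))).re = c := by
    intro i
    have h1 : b (f i) = e i := congrFun hb (f i)
    have h2 : A (e i) = (c : ℂ) • e i := by simp only [he, map_smul, h]; rw [smul_comm]
    rw [h1, h2, inner_smul_right, inner_self_eq_norm_sq_to_K, hnorm]
    simp
  rw [← hsum]
  calc Fintype.card ι * c = ∑ i : ι, (inner ℂ (b (f i)) (A (b (f i)))).re := by simp [he']
    _ = ∑ i ∈ Finset.univ.map ⟨f, hf⟩, (inner ℂ (b i) (A (b i))).re := by simp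
    _ ≤ _ := Finset.sum_le_sum_of_subset_of_nonneg (Finset.subset_univ _)
      fun i _ _ => hA.re_inner_nonneg_right (b i)

end InnerProduct

/-! ### The adjoint action on operators and its Casimir. -/

section HilbertSchmidt

variable {d : ℕ}

/-- The Hilbert-Schmidt inner product `tr (X† Y)`. -/
@[reducible] noncomputable def hilbertSchmidtCore (d : ℕ) : InnerProductSpace.Core ℂ (Op d) where
  inner X Y := (Xᴴ * Y).trace
  conj_inner_symm X Y := by
    rw [starRingEnd_apply, ← Matrix.trace_conjTranspose, Matrix.conjTranspose_mul,
      Matrix.conjTranspose_conjTranspose]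
  re_inner_nonneg X :=
    (RCLike.nonneg_iff.mp (Matrix.posSemidef_conjTranspose_mul_self X).trace_nonneg).1
  add_left X Y Z := by simp [add_mul]
  smul_left X Y r := by simp
  definite X hX := Matrix.trace_conjTranspose_mul_self_eq_zero_iff.mp hX

@[reducible] noncomputable def hilbertSchmidtNormedAddCommGroup (d : ℕ) :
    NormedAddCommGroup (Op d) :=
  (hilbertSchmidtCore d).toNormedAddCommGroup

attribute [local instance] hilbertSchmidtNormedAddCommGroup

@[reducible] noncomputable def hilbertSchmidtInnerProductSpace (d : ℕ) :
    InnerProductSpace ℂ (Op d) :=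
  InnerProductSpace.ofCore (hilbertSchmidtCore d).toCore

attribute [local instance] hilbertSchmidtInnerProductSpace

theorem hilbertSchmidt_inner (X Y : Op d) : inner ℂ X Y = (Xᴴ * Y).trace := rfl

/-- The commutator `Y ↦ X Y - Y X`. -/
def ad (X : Op d) : Module.End ℂ (Op d) := LinearMap.mulLeft ℂ X - LinearMap.mulRight ℂ X

@[simp] theorem ad_apply (X Y : Op d) : ad X Y = X * Y - Y * X := rfl

theorem ad_add (X Y : Op d) : ad (X + Y) = ad X + ad Y := by
  ext1 Z; simp [add_mul, mul_add]; abel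

theorem ad_sub (X Y : Op d) : ad (X - Y) = ad X - ad Y := by
  ext1 Z; simp [sub_mul, mul_sub]; abel

theorem ad_smul (c : ℂ) (X : Op d) : ad (c • X) = c • ad X := by
  ext1 Z; simp [smul_sub]

theorem ad_commutator (X Y : Op d) : ad X * ad Y - ad Y * ad X = ad (X * Y - Y * X) := by
  ext1 Z; simp; noncomm_ring

theorem isSymmetric_ad {X : Op d} (hX : X.IsHermitian) : (ad X).IsSymmetric := by
  intro Y Z
  simp only [hilbertSchmidt_inner, ad_apply, Matrix.conjTranspose_sub, Matrix.conjTranspose_mul,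
    hX.eq, sub_mul, mul_sub, Matrix.trace_sub]
  rw [mul_assoc, ← mul_assoc Yᴴ Z X, Matrix.trace_mul_comm (Yᴴ * Z) X, ← mul_assoc X]

variable {J : Fin 3 → Op d}

theorem commute_ad_raising {T : Module.End ℂ (Op d)} (hc : ∀ k, Commute T (ad (J k))) :
    Commute T (ad (raising J)) := by
  rw [raising, ad_add, ad_smul]
  exact (hc 0).add_right ((hc 1).smul_right _)

theorem commute_ad_lowering {T : Module.End ℂ (Op d)} (hc : ∀ k, Commute T (ad (J k))) :
    Commute T (ad (lowering J)) := by
  rw [lowering, ad_sub, ad_smul]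
  exact (hc 0).sub_right ((hc 1).smul_right _)

theorem commute_sum_sq {A : Type*} [Ring A] [Algebra ℂ A] {x y z : A}
    (hxy : x * y - y * x = Complex.I • z)
    (hzx : z * x - x * z = Complex.I • y) : Commute (x * x + y * y + z * z) x := by
  have h : (x * x + y * y + z * z) * x - x * (x * x + y * y + z * z) =
      -(y * (x * y - y * x) + (x * y - y * x) * y) + z * (z * x - x * z) +
        (z * x - x * z) * z := by noncomm_ring
  rw [commute_iff_eq, ← sub_eq_zero, h, hxy, hzx]
  simp only [mul_smul_comm, smul_mul_assoc]
  abel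

/-- The Casimir operator of the adjoint action. -/
def casimir (J : Fin 3 → Op d) : Op d →ₗ[ℂ] Op d := ∑ k, ad (J k) * ad (J k)

namespace IsAngularMomentum

/-- A symmetric operator that commutes with the adjoint action is positive as soon as its values
on the highest weight vectors are. -/
theorem isPositive_of_commute [NeZero d] (h : IsAngularMomentum J) {T : Op d →ₗ[ℂ] Op d}
    (hT : T.IsSymmetric) (hc : ∀ k, Commute T (ad (J k)))
    (hpos : ∀ n < d, raising J ^ n ≠ 0 → ∀ c : ℝ, T (raising J ^ n) = (c : ℂ) • raising J ^ n → 0 ≤ c) :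
    T.IsPositive := by
  obtain ⟨w, hw⟩ := h.exists_isLowestWeight
  refine isPositive_of_forall_eigenvalue hT fun c x hx0 hx => ?_
  -- The eigenspace is stable under the adjoint action, so it contains a highest weight vector,
  -- which can only be a multiple of a raising power; the eigenvalue can be read there.
  have hW : Module.End.eigenspace T (c : ℂ) ≠ ⊥ := fun hbot => hx0 <| by
    have : x ∈ Module.End.eigenspace T (c : ℂ) := Module.End.mem_eigenspace_iff.mpr hx
    rwa [hbot, Submodule.mem_bot] at this
  have hinv : ∀ S : Module.End ℂ (Op d), Commute T S → ∀ y ∈ Module.End.eigenspace T (c : ℂ),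
      S y ∈ Module.End.eigenspace T (c : ℂ) := by
    intro S hS y hy
    rw [Module.End.mem_eigenspace_iff] at hy ⊢
    rw [← Module.End.mul_apply, hS.eq, Module.End.mul_apply, hy, map_smul]
  obtain ⟨y, hy, hy0, hPy, μ, hZy⟩ := exists_ladder_top_mem (Z := ad (J 2)) (P := ad (raising J))
    one_ne_zero (by rw [ad_commutator, h.commutator_raising, one_smul]) hW (hinv _ (hc 2))
    (hinv _ (commute_ad_raising hc))
  obtain ⟨n, hn, -, a, rfl⟩ := hw.exists_eq_smul_pow hy0 hPy hZy
  refine hpos n hn (hw.raising_pow_ne_zero hn) c ?_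
  rw [Module.End.mem_eigenspace_iff, map_smul, smul_comm] at hy
  exact smul_right_injective _ (left_ne_zero_of_smul hy0) hy

/-- Schur's lemma. -/
theorem exists_eq_smul_one [NeZero d] (h : IsAngularMomentum J) {X : Op d}
    (hX : ∀ k, J k * X - X * J k = 0) : ∃ c : ℂ, X = c • (1 : Op d) := by
  obtain ⟨w, hw⟩ := h.exists_isLowestWeight
  by_cases hX0 : X = 0
  · exact ⟨0, by simp [hX0]⟩
  have hP : raising J * X - X * raising J = 0 := by
    have : raising J * X - X * raising J =
        (J 0 * X - X * J 0) + Complex.I • (J 1 * X - X * J 1) := by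
      simp only [raising, add_mul, mul_add, smul_mul_assoc, mul_smul_comm, smul_sub]; abel
    rw [this, hX, hX]; simp
  obtain ⟨n, -, hn, c, hc⟩ := hw.exists_eq_smul_pow hX0 hP (μ := 0) (by rw [hX, zero_smul])
  obtain rfl : n = 0 := by exact_mod_cast hn.symm
  exact ⟨c, by rw [hc, pow_zero]⟩

theorem ad_raising_pow (h : IsAngularMomentum J) (n : ℕ) :
    ad (J 2) (raising J ^ n) = (n : ℂ) • raising J ^ n := by
  induction n with
  | zero => simp
  | succ n ih =>
    have h1 : J 2 * raising J ^ (n + 1) - raising J ^ (n + 1) * J 2 =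
        (J 2 * raising J ^ n - raising J ^ n * J 2) * raising J +
          raising J ^ n * (J 2 * raising J - raising J * J 2) := by
      rw [pow_succ]; noncomm_ring
    rw [ad_apply] at ih ⊢
    rw [h1, ih, h.commutator_raising, smul_mul_assoc, ← pow_succ]
    push_cast
    module

theorem trace_raising_pow (h : IsAngularMomentum J) {n : ℕ} (hn : n ≠ 0) :
    (raising J ^ n).trace = 0 := by
  have h1 := congrArg Matrix.trace (h.ad_raising_pow n)
  rw [ad_apply, Matrix.trace_sub, Matrix.trace_mul_comm, sub_self, Matrix.trace_smul, smul_eq_mul,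
    eq_comm, mul_eq_zero] at h1
  exact h1.resolve_left (by exact_mod_cast hn)

theorem isSymmetric_casimir (h : IsAngularMomentum J) : (casimir J).IsSymmetric :=
  LinearMap.isSymmetric_sum _ fun k _ => by
    intro X Y
    rw [Module.End.mul_apply, Module.End.mul_apply, isSymmetric_ad (h.hermitian k),
      isSymmetric_ad (h.hermitian k)]

/-- The raising factor stands on the right so that its term vanishes on highest weight vectors. -/
theorem casimir_eq (h : IsAngularMomentum J) :
    casimir J = ad (lowering J) * ad (raising J) + ad (J 2) * ad (J 2) + ad (J 2) := by
  have h1 := ad_commutator (J 0) (J 1)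
  rw [show J 0 * J 1 - J 1 * J 0 = Complex.I • J 2 from h.commutator 0, ad_smul] at h1
  have h2 : ad (J 2) = (-Complex.I) • (ad (J 0) * ad (J 1) - ad (J 1) * ad (J 0)) := by
    rw [h1, smul_smul]; simp
  have h3 : ad (lowering J) * ad (raising J) = ad (J 0) * ad (J 0) + ad (J 1) * ad (J 1) -
      (-Complex.I) • (ad (J 0) * ad (J 1) - ad (J 1) * ad (J 0)) := by
    simp only [raising, lowering, ad_add, ad_sub, ad_smul, mul_add, sub_mul, mul_smul_comm,
      smul_mul_assoc, smul_smul, smul_sub, Complex.I_mul_I]; module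
  rw [h3, ← h2, casimir, Fin.sum_univ_three]
  abel

theorem commute_casimir (h : IsAngularMomentum J) (k : Fin 3) : Commute (casimir J) (ad (J k)) := by
  have hc : ∀ a, ad (J a) * ad (J (a + 1)) - ad (J (a + 1)) * ad (J a) =
      Complex.I • ad (J (a + 2)) := fun a => by rw [ad_commutator, h.commutator, ad_smul]
  have h0 := hc 0
  have h1 := hc 1
  have h2 := hc 2
  simp only [Fin.isValue, Fin.reduceAdd] at h0 h1 h2
  rw [casimir, Fin.sum_univ_three]
  fin_cases k
  · exact commute_sum_sq h0 h2
  · convert! commute_sum_sq h1 h0 using 1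
    abel
  · convert! commute_sum_sq h2 h1 using 1
    abel

theorem casimir_raising_pow (h : IsAngularMomentum J) (n : ℕ) :
    casimir J (raising J ^ n) = ((n * (n + 1) : ℝ) : ℂ) • raising J ^ n := by
  have h1 : ad (raising J) (raising J ^ n) = 0 := by
    rw [ad_apply, ← pow_succ, ← pow_succ', sub_self]
  rw [h.casimir_eq]
  simp only [LinearMap.add_apply, Module.End.mul_apply, h1, h.ad_raising_pow, map_smul, map_zero]
  push_cast
  module

end IsAngularMomentum

end HilbertSchmidt

/-! ### The Choi operator: covariance, positivity, traces. -/

section Choi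

variable {d : ℕ}

attribute [local instance] hilbertSchmidtNormedAddCommGroup
attribute [local instance] hilbertSchmidtInnerProductSpace

/-- The operator on `ℂ^d ⊗ ℂ^d` with matrix elements `⟨k| 𝓔(|i⟩⟨i'|) |k'⟩`, seen as an operator
on `Op d`. -/
def choi (E : Op d →ₗ[ℂ] Op d) : Op d →ₗ[ℂ] Op d :=
  ∑ i, ∑ k, LinearMap.mulLeft ℂ (E (Matrix.single i k 1)) *
    LinearMap.mulRight ℂ (Matrix.single k i 1)

theorem choi_apply (E : Op d →ₗ[ℂ] Op d) (X : Op d) :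
    choi E X = ∑ i, ∑ k, E (Matrix.single i k 1) * X * Matrix.single k i 1 := by
  simp [choi, mul_assoc]

theorem choi_apply_apply (E : Op d →ₗ[ℂ] Op d) (X : Op d) (a b : Fin d) :
    choi E X a b = ∑ k, ∑ l, E (Matrix.single b k 1) a l * X l k := by
  rw [choi_apply, Matrix.sum_apply]
  simp only [Matrix.sum_apply, Matrix.mul_apply (N := Matrix.single _ _ _), Matrix.single_apply,
    mul_ite, mul_one, mul_zero]
  rw [Finset.sum_eq_single b]
  · simp [Matrix.mul_apply]
  · intro i _ hi
    simp [hi]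
  · simp

theorem map_eq_sum (E : Op d →ₗ[ℂ] Op d) (X : Op d) :
    E X = ∑ i, ∑ k, X i k • E (Matrix.single i k 1) := by
  conv_lhs => rw [Matrix.matrix_eq_sum_single X]
  simp only [map_sum]
  refine Finset.sum_congr rfl fun i _ => Finset.sum_congr rfl fun k _ => ?_
  rw [← map_smul, Matrix.smul_single, smul_eq_mul, mul_one]

/-- A factor on one matrix unit slides to the other: Σ A E_ik ⊗ E_ki = Σ E_ik ⊗ E_ki A. The next
lemma uses Σ E_ik A ⊗ E_ki = Σ E_ik ⊗ A E_ki. -/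
theorem sum_map_mul_single_left (E : Op d →ₗ[ℂ] Op d) (A X : Op d) :
    ∑ i, ∑ k, E (A * Matrix.single i k 1) * X * Matrix.single k i 1 = choi E X * A := by
  have h1 : ∀ i k : Fin d, A * Matrix.single i k 1 = ∑ l, A l i • Matrix.single l k (1 : ℂ) := by
    intro i k
    ext a b
    simp [Matrix.mul_apply, Matrix.sum_apply, Matrix.single_apply, ite_and]
  have h2 : ∀ i k : Fin d, Matrix.single k i 1 * A = ∑ l, A i l • Matrix.single k l (1 : ℂ) := by
    intro i k
    ext a b
    simp [Matrix.mul_apply, Matrix.sum_apply, Matrix.single_apply, ite_and]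
  simp only [choi_apply, Finset.sum_mul, mul_assoc, h1, h2, map_sum, map_smul, Finset.mul_sum,
    smul_mul_assoc, mul_smul_comm]
  rw [Finset.sum_comm]
  conv_rhs => rw [Finset.sum_comm]
  refine Finset.sum_congr rfl fun k _ => ?_
  rw [Finset.sum_comm]

theorem sum_map_mul_single_right (E : Op d →ₗ[ℂ] Op d) (A X : Op d) :
    ∑ i, ∑ k, E (Matrix.single i k 1 * A) * X * Matrix.single k i 1 = choi E (X * A) := by
  have h1 : ∀ i k : Fin d, A * Matrix.single i k 1 = ∑ l, A l i • Matrix.single l k (1 : ℂ) := by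
    intro i k
    ext a b
    simp [Matrix.mul_apply, Matrix.sum_apply, Matrix.single_apply, ite_and]
  have h2 : ∀ i k : Fin d, Matrix.single k i 1 * A = ∑ l, A i l • Matrix.single k l (1 : ℂ) := by
    intro i k
    ext a b
    simp [Matrix.mul_apply, Matrix.sum_apply, Matrix.single_apply, ite_and]
  simp only [choi_apply, Finset.sum_mul, mul_assoc, h1, h2, map_sum, map_smul, Finset.mul_sum,
    smul_mul_assoc, mul_smul_comm]
  refine Finset.sum_congr rfl fun k _ => ?_
  rw [Finset.sum_comm]

theorem commute_choi {E : Op d →ₗ[ℂ] Op d} {A : Op d}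
    (hE : ∀ X, E (A * X - X * A) = A * E X - E X * A) : Commute (choi E) (ad A) := by
  rw [commute_iff_eq]
  ext1 X
  have h1 : choi E (A * X) = A * choi E X -
      (∑ i, ∑ k, E (A * Matrix.single i k 1) * X * Matrix.single k i 1 -
        ∑ i, ∑ k, E (Matrix.single i k 1 * A) * X * Matrix.single k i 1) := by
    simp only [choi_apply, Finset.mul_sum, ← Finset.sum_sub_distrib]
    refine Finset.sum_congr rfl fun i _ => Finset.sum_congr rfl fun k _ => ?_
    rw [← sub_mul, ← sub_mul, ← map_sub, hE]
    noncomm_ring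
  rw [sum_map_mul_single_left, sum_map_mul_single_right] at h1
  simp only [Module.End.mul_apply, ad_apply, map_sub, h1]
  abel

/-- The ampliation is applied to the unnormalized maximally entangled projector, giving the usual
Choi matrix; `X` is vectorized with its indices swapped. Hence complete positivity is needed only at
`k = d`. -/
theorem inner_choi (E : Op d →ₗ[ℂ] Op d) (X : Op d) :
    inner ℂ X (choi E X) = star (fun x : Fin d × Fin d => X x.2 x.1) ⬝ᵥ
      (ampliation E d (Matrix.of fun x y => if x.1 = x.2 ∧ y.1 = y.2 then 1 else 0) *ᵥ
        fun x => X x.2 x.1) := by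
  have h1 : ∀ i k : Fin d, (Matrix.of fun a b : Fin d => if i = a ∧ k = b then (1 : ℂ) else 0) =
      Matrix.single i k 1 := by
    intro i k; ext a b; simp [Matrix.single_apply]
  simp only [hilbertSchmidt_inner, Matrix.trace, Matrix.diag_apply, Matrix.mul_apply,
    Matrix.conjTranspose_apply, dotProduct, Matrix.mulVec, Fintype.sum_prod_type, Pi.star_apply,
    ampliation, Matrix.of_apply, h1, choi_apply_apply]

theorem isPositive_choi {E : Op d →ₗ[ℂ] Op d} (hE : IsQuantumChannel E) :
    (choi E).IsPositive := by
  have hM : (Matrix.of fun x y : Fin d × Fin d =>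
      if x.1 = x.2 ∧ y.1 = y.2 then (1 : ℂ) else 0).PosSemidef := by
    convert! Matrix.posSemidef_vecMulVec_self_star
      (fun x : Fin d × Fin d => if x.1 = x.2 then (1 : ℂ) else 0) using 1
    ext x y
    simp [Matrix.vecMulVec_apply, ← ite_and, and_comm]
  have h := hE.completelyPositive d _ hM
  rw [LinearMap.isPositive_iff_complex]
  intro X
  have h1 := h.dotProduct_mulVec_nonneg (fun x => X x.2 x.1)
  rw [← inner_choi] at h1
  rw [Complex.nonneg_iff] at h1
  have h2 : inner ℂ (choi E X) X = inner ℂ X (choi E X) := by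
    rw [← inner_conj_symm, Complex.conj_eq_iff_im, h1.2]
  rw [h2]
  exact ⟨Complex.ext rfl h1.2, h1.1⟩

theorem trace_mulLeft_mul_mulRight (A B : Op d) :
    LinearMap.trace ℂ (Op d) (LinearMap.mulLeft ℂ A * LinearMap.mulRight ℂ B) =
      A.trace * B.trace := by
  rw [LinearMap.trace_eq_matrix_trace ℂ (Matrix.stdBasis ℂ (Fin d) (Fin d))]
  simp only [Matrix.trace, Matrix.diag_apply, LinearMap.toMatrix_apply, Fintype.sum_prod_type,
    Finset.sum_mul_sum]
  refine Finset.sum_congr rfl fun i _ => Finset.sum_congr rfl fun k _ => ?_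
  simp [Matrix.stdBasis_eq_single]
  change (A * (Matrix.single i k 1 * B) : Op d) i k = _
  simp [Matrix.mul_apply, Matrix.single_apply, ite_and]

/-- Left times right multiplication is a tensor product, and pairing with it reads off matrix
elements of `E`. The traces of C, C² and C casimir all come from this formula. -/
theorem trace_choi_mul (E : Op d →ₗ[ℂ] Op d) (A B : Op d) :
    LinearMap.trace ℂ (Op d) (choi E * (LinearMap.mulLeft ℂ A * LinearMap.mulRight ℂ B)) =
      (E B * A).trace := by
  have h1 : ∀ i k : Fin d, LinearMap.mulLeft ℂ (E (Matrix.single i k 1)) *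
      LinearMap.mulRight ℂ (Matrix.single k i 1) *
        (LinearMap.mulLeft ℂ A * LinearMap.mulRight ℂ B) =
      LinearMap.mulLeft ℂ (E (Matrix.single i k 1) * A) *
        LinearMap.mulRight ℂ (B * Matrix.single k i 1) := by
    intro i k; ext1 X; simp [mul_assoc]
  simp only [choi, Finset.sum_mul, h1, map_sum, trace_mulLeft_mul_mulRight]
  rw [map_eq_sum E B]
  simp only [Finset.sum_mul, Matrix.trace_sum, smul_mul_assoc, Matrix.trace_smul, smul_eq_mul]
  refine Finset.sum_congr rfl fun i _ => Finset.sum_congr rfl fun k _ => ?_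
  rw [Matrix.trace_mul_single]
  simp [mul_comm]

theorem trace_choi (E : Op d →ₗ[ℂ] Op d) :
    LinearMap.trace ℂ (Op d) (choi E) = (E 1).trace := by
  have h := trace_choi_mul E 1 1
  rwa [LinearMap.mulLeft_one, LinearMap.mulRight_one, ← Module.End.one_eq_id, mul_one, mul_one,
    mul_one] at h

theorem trace_choi_mul_self (E : Op d →ₗ[ℂ] Op d) :
    LinearMap.trace ℂ (Op d) (choi E * choi E) =
      ∑ i, ∑ k, (E (Matrix.single i k 1) * E (Matrix.single k i 1)).trace := by
  conv_lhs => enter [2, 2]; rw [choi]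
  simp only [Finset.mul_sum, map_sum, trace_choi_mul]
  refine Finset.sum_congr rfl fun i _ => Finset.sum_congr rfl fun k _ => ?_
  rw [Matrix.trace_mul_comm]

end Choi

/-! ### Trace inequalities for positive operators commuting with the adjoint action. -/

section Spectral

variable {d : ℕ}

attribute [local instance] hilbertSchmidtNormedAddCommGroup
attribute [local instance] hilbertSchmidtInnerProductSpace

/-- The orthogonal projection of operators onto the multiples of the identity. -/
noncomputable def scalarPart (d : ℕ) : Op d →ₗ[ℂ] Op d :=
  (Matrix.traceLinearMap (Fin d) ℂ ℂ).smulRight ((d : ℂ)⁻¹ • (1 : Op d))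

theorem scalarPart_apply (X : Op d) : scalarPart d X = X.trace • (d : ℂ)⁻¹ • (1 : Op d) := rfl

theorem isSymmetric_scalarPart : (scalarPart d).IsSymmetric := by
  intro X Y
  simp [hilbertSchmidt_inner, scalarPart_apply]
  ring

theorem commute_scalarPart_ad (A : Op d) : Commute (scalarPart d) (ad A) := by
  rw [commute_iff_eq]
  ext1 X
  simp [scalarPart_apply, Matrix.trace_mul_comm A X]

theorem scalarPart_one [NeZero d] : scalarPart d 1 = 1 := by
  have : (d : ℂ) ≠ 0 := by exact_mod_cast NeZero.ne d
  rw [scalarPart_apply, Matrix.trace_one, Fintype.card_fin, smul_smul, mul_inv_cancel₀ this,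
    one_smul]

theorem scalarPart_mul_self [NeZero d] : scalarPart d * scalarPart d = scalarPart d := by
  ext1 X
  rw [Module.End.mul_apply, scalarPart_apply X, map_smul, map_smul, scalarPart_one]

theorem trace_scalarPart [NeZero d] : LinearMap.trace ℂ (Op d) (scalarPart d) = 1 := by
  have : (d : ℂ) ≠ 0 := by exact_mod_cast NeZero.ne d
  rw [scalarPart, LinearMap.trace_smulRight]
  simp [this]

variable {C : Op d →ₗ[ℂ] Op d} {q : ℝ}

theorem mul_scalarPart (hq : C 1 = (q : ℂ) • (1 : Op d)) :
    C * scalarPart d = (q : ℂ) • scalarPart d := by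
  ext1 X
  simp only [Module.End.mul_apply, scalarPart_apply, map_smul, hq, LinearMap.smul_apply]
  module

theorem scalarPart_mul (hC : C.IsSymmetric) (hq : C 1 = (q : ℂ) • (1 : Op d)) :
    scalarPart d * C = (q : ℂ) • scalarPart d := by
  ext1 X
  have h1 : (C X).trace = q * X.trace := by
    have := hC 1 X
    rw [hq] at this
    simpa [hilbertSchmidt_inner] using this.symm
  simp only [Module.End.mul_apply, scalarPart_apply, h1, LinearMap.smul_apply]
  module

theorem trace_sub_smul_scalarPart [NeZero d] :
    LinearMap.trace ℂ (Op d) (C - (q : ℂ) • scalarPart d) = LinearMap.trace ℂ (Op d) C - q := by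
  simp [trace_scalarPart]

theorem trace_sub_smul_scalarPart_mul_self [NeZero d] (hC : C.IsSymmetric)
    (hq : C 1 = (q : ℂ) • (1 : Op d)) :
    LinearMap.trace ℂ (Op d) ((C - (q : ℂ) • scalarPart d) * (C - (q : ℂ) • scalarPart d)) =
      LinearMap.trace ℂ (Op d) (C * C) - q ^ 2 := by
  have : (C - (q : ℂ) • scalarPart d) * (C - (q : ℂ) • scalarPart d) =
      C * C - ((q : ℂ) ^ 2) • scalarPart d := by
    rw [sub_mul, mul_sub, mul_sub, mul_smul_comm, smul_mul_assoc, mul_scalarPart hq,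
      scalarPart_mul hC hq, smul_mul_assoc, mul_smul_comm, scalarPart_mul_self]
    module
  rw [this, map_sub, map_smul, trace_scalarPart, smul_eq_mul, mul_one]

theorem sq_le_trace_mul_self [NeZero d] (hC : C.IsSymmetric)
    (hq : C 1 = (q : ℂ) • (1 : Op d)) :
    q ^ 2 ≤ (LinearMap.trace ℂ (Op d) (C * C)).re := by
  have h1 := re_trace_sq_nonneg
    (hC.sub ((isSymmetric_scalarPart (d := d)).smul (Complex.conj_ofReal q)))
  rw [trace_sub_smul_scalarPart_mul_self hC hq, ← Complex.ofReal_pow, Complex.sub_re,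
    Complex.ofReal_re] at h1
  exact sub_nonneg.mp h1

variable {J : Fin 3 → Op d}

namespace IsAngularMomentum

theorem scalarPart_raising_pow (h : IsAngularMomentum J) {n : ℕ} (hn : n ≠ 0) :
    scalarPart d (raising J ^ n) = 0 := by
  rw [scalarPart_apply, h.trace_raising_pow hn, zero_smul]

/-- `scalarPart` kills J₊^n for n ≥ 1, so only the eigenvalue on the identity changes, from `q` to
zero. -/
theorem isPositive_sub_smul_scalarPart [NeZero d] (h : IsAngularMomentum J) (hC : C.IsPositive)
    (hc : ∀ k, Commute C (ad (J k))) (hq : C 1 = (q : ℂ) • (1 : Op d)) :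
    (C - (q : ℂ) • scalarPart d).IsPositive := by
  refine h.isPositive_of_commute
    (hC.isSymmetric.sub (isSymmetric_scalarPart.smul (Complex.conj_ofReal q)))
    (fun k => (hc k).sub_left ((commute_scalarPart_ad _).smul_left _)) fun n _ hn0 c hn => ?_
  rcases eq_or_ne n 0 with rfl | hn'
  · rw [pow_zero, LinearMap.sub_apply, LinearMap.smul_apply, scalarPart_one, hq, sub_self,
      eq_comm, smul_eq_zero] at hn
    rw [pow_zero] at hn0
    have := hn.resolve_right hn0
    exact (Complex.ofReal_eq_zero.mp this).ge
  · rw [LinearMap.sub_apply, LinearMap.smul_apply, h.scalarPart_raising_pow hn', smul_zero,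
      sub_zero] at hn
    have h1 := hC.re_inner_nonneg_right (raising J ^ n)
    rw [hn, inner_smul_right, inner_self_eq_norm_sq_to_K] at h1
    have h2 : RCLike.re ((c : ℂ) * (‖raising J ^ n‖ : ℂ) ^ 2) = c * ‖raising J ^ n‖ ^ 2 := by
      exact_mod_cast Complex.ofReal_re _
    have h3 : 0 ≤ c * ‖raising J ^ n‖ ^ 2 := h1.trans_eq h2
    exact nonneg_of_mul_nonneg_left h3 (by positivity)

/-- Every eigenvalue of a traceless highest weight vector occurs at least three times. -/
theorem three_mul_le_trace (h : IsAngularMomentum J) {A : Op d →ₗ[ℂ] Op d} (hA : A.IsPositive)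
    (hc : ∀ k, Commute A (ad (J k))) {n : ℕ} (hn : n ≠ 0) (hn0 : raising J ^ n ≠ 0) {c : ℝ}
    (hAn : A (raising J ^ n) = (c : ℂ) • raising J ^ n) :
    3 * c ≤ (LinearMap.trace ℂ (Op d) A).re := by
  set M := ad (lowering J) with hM
  set P := ad (raising J) with hP
  set Z := ad (J 2) with hZ
  set x₀ : Op d := raising J ^ n with hx₀
  have hPM : ∀ x, P (M x) = M (P x) + (2 : ℂ) • Z x := fun x => by
    have := LinearMap.congr_fun (ad_commutator (raising J) (lowering J)) x
    rw [h.commutator_raising_lowering, ad_smul] at this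
    simp only [LinearMap.sub_apply, Module.End.mul_apply, LinearMap.smul_apply] at this
    rw [← this]; abel
  have hZM : ∀ x, Z (M x) = M (Z x) - M x := fun x => by
    have := LinearMap.congr_fun (ad_commutator (J 2) (lowering J)) x
    rw [h.commutator_lowering, ← neg_one_smul ℂ (lowering J), ad_smul] at this
    simp only [LinearMap.sub_apply, Module.End.mul_apply, LinearMap.smul_apply] at this
    rw [sub_eq_iff_eq_add] at this
    rw [this]; module
  have hP0 : P x₀ = 0 := by rw [hP, ad_apply, hx₀, ← pow_succ, ← pow_succ', sub_self]
  have hZ0 : Z x₀ = ((n : ℝ) : ℂ) • x₀ := h.ad_raising_pow n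
  have hZ1 : Z (M x₀) = ((n - 1 : ℝ) : ℂ) • M x₀ := by
    rw [hZM, hZ0, map_smul]; push_cast; module
  have hZ2 : Z (M (M x₀)) = ((n - 2 : ℝ) : ℂ) • M (M x₀) := by
    rw [hZM, hZ1, map_smul]; push_cast; module
  have hP1 : P (M x₀) = (2 * n : ℂ) • x₀ := by
    rw [hPM, hP0, map_zero, hZ0]; push_cast; module
  have hP2 : P (M (M x₀)) = (4 * n - 2 : ℂ) • M x₀ := by
    rw [hPM, hP1, hZ1, map_smul]; push_cast; module
  -- Raising back multiplies by 2n and by 4n − 2, neither of which is zero for n ≥ 1.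
  have hx1 : M x₀ ≠ 0 := fun h0 => by
    rw [h0, map_zero, eq_comm, smul_eq_zero] at hP1
    have := hP1.resolve_right hn0
    simp [hn] at this
  have hx2 : M (M x₀) ≠ 0 := fun h0 => by
    rw [h0, map_zero, eq_comm, smul_eq_zero] at hP2
    have h1 := hP2.resolve_right hx1
    have h2 : ((4 * n : ℕ) : ℂ) = (2 : ℕ) := by push_cast; linear_combination h1
    have := Nat.cast_injective h2
    omega
  have hcM : ∀ x, A (M x) = M (A x) := fun x => LinearMap.congr_fun (commute_ad_lowering hc).eq x
  have hA1 : A (M x₀) = (c : ℂ) • M x₀ := by rw [hcM, hAn, map_smul]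
  have hA2 : A (M (M x₀)) = (c : ℂ) • M (M x₀) := by rw [hcM, hA1, map_smul]
  have hsym : Z.IsSymmetric := isSymmetric_ad (h.hermitian 2)
  -- The three vectors have the distinct weights n, n − 1, n − 2 for a symmetric operator, so they
  -- are orthogonal.
  have horth : ∀ {a b : ℝ} {x y : Op d}, a ≠ b → Z x = (a : ℂ) • x → Z y = (b : ℂ) • y →
      inner ℂ x y = 0 := fun {a b x y} hab hx hy => by
    have h1 := hsym x y
    rw [hx, hy, inner_smul_left, inner_smul_right, Complex.conj_ofReal, ← sub_eq_zero, ← sub_mul,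
      mul_eq_zero] at h1
    exact h1.resolve_left (sub_ne_zero.mpr (by exact_mod_cast hab))
  have hwt_inj : Function.Injective fun i : Fin 3 => (n - (i : ℕ) : ℝ) := fun a b hab =>
    Fin.ext (by simpa using hab)
  have hwt : ∀ i : Fin 3, Z (![x₀, M x₀, M (M x₀)] i) =
      ((n - (i : ℕ) : ℝ) : ℂ) • ![x₀, M x₀, M (M x₀)] i := by
    intro i
    fin_cases i
    exacts [by simpa using hZ0, by simpa using hZ1, by simpa using hZ2]
  have key := card_mul_eigenvalue_le_trace hA (x := ![x₀, M x₀, M (M x₀)]) (c := c)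
    (by intro i; fin_cases i; exacts [hn0, hx1, hx2])
    (fun i k hik => horth (hwt_inj.ne hik) (hwt i) (hwt k))
    (by intro i; fin_cases i; exacts [hAn, hA1, hA2])
  simpa using key

theorem le_trace [NeZero d] (h : IsAngularMomentum J) (hC : C.IsPositive)
    (hc : ∀ k, Commute C (ad (J k))) (hq : C 1 = (q : ℂ) • (1 : Op d)) :
    q ≤ (LinearMap.trace ℂ (Op d) C).re := by
  have h1 := re_trace_nonneg (h.isPositive_sub_smul_scalarPart hC hc hq)
  rw [trace_sub_smul_scalarPart] at h1
  simpa using h1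

/-- The part A of `C` off the identity has eigenvalues at most τ/3 with τ = tr A, each nonzero one
occurring at least three times. So A ≤ τ/3, and multiplying by A ≥ 0 gives tr A² ≤ τ²/3. -/
theorem trace_mul_self_le [NeZero d] (h : IsAngularMomentum J) (hC : C.IsPositive)
    (hc : ∀ k, Commute C (ad (J k))) (hq : C 1 = (q : ℂ) • (1 : Op d)) :
    (LinearMap.trace ℂ (Op d) (C * C)).re ≤
      q ^ 2 + ((LinearMap.trace ℂ (Op d) C).re - q) ^ 2 / 3 := by
  set A := C - (q : ℂ) • scalarPart d with hA
  have hApos : A.IsPositive := h.isPositive_sub_smul_scalarPart hC hc hq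
  have hAc : ∀ k, Commute A (ad (J k)) := fun k =>
    (hc k).sub_left ((commute_scalarPart_ad _).smul_left _)
  have htr : (LinearMap.trace ℂ (Op d) A).re = (LinearMap.trace ℂ (Op d) C).re - q := by
    rw [hA, trace_sub_smul_scalarPart]; simp
  have hsq : (LinearMap.trace ℂ (Op d) (A * A)).re =
      (LinearMap.trace ℂ (Op d) (C * C)).re - q ^ 2 := by
    rw [hA, trace_sub_smul_scalarPart_mul_self hC.isSymmetric hq, ← Complex.ofReal_pow,
      Complex.sub_re, Complex.ofReal_re]
  set τ := (LinearMap.trace ℂ (Op d) C).re - q with hτ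
  have hτ0 : 0 ≤ τ := htr ▸ re_trace_nonneg hApos
  have hB : ((τ / 3 : ℝ) : ℂ) • (1 : Op d →ₗ[ℂ] Op d) - A |>.IsPositive := by
    refine h.isPositive_of_commute
      ((LinearMap.IsSymmetric.one.smul (Complex.conj_ofReal _)).sub hApos.isSymmetric)
      (fun k => ((Commute.one_left _).smul_left _).sub_left (hAc k)) fun n _ hn0 c hn => ?_
    rw [LinearMap.sub_apply, LinearMap.smul_apply, Module.End.one_apply] at hn
    have hAn : A (raising J ^ n) = ((τ / 3 - c : ℝ) : ℂ) • raising J ^ n := by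
      rw [sub_eq_iff_eq_add] at hn
      rw [Complex.ofReal_sub, sub_smul, hn]; abel
    rcases eq_or_ne n 0 with rfl | hn'
    · rw [pow_zero, hA, LinearMap.sub_apply, LinearMap.smul_apply, scalarPart_one, hq, sub_self,
        eq_comm, smul_eq_zero] at hAn
      have h1 := Complex.ofReal_eq_zero.mp (hAn.resolve_right hn0)
      linarith
    · have h1 := h.three_mul_le_trace hApos hAc hn' hn0 hAn
      rw [htr] at h1
      linarith
  have h1 := re_trace_mul_nonneg hApos hB
  rw [mul_sub, mul_smul_comm, mul_one, map_sub, map_smul, smul_eq_mul, Complex.sub_re,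
    Complex.re_ofReal_mul, htr, hsq] at h1
  nlinarith

/-- The Casimir is n(n + 1) ≥ 2 on J₊^n for n ≥ 1, and both terms vanish on the identity. The
companion bound below uses n ≤ d − 1. -/
theorem isPositive_casimir_sub [NeZero d] (h : IsAngularMomentum J) :
    (casimir J - (2 : ℂ) • (1 - scalarPart d)).IsPositive := by
  have h2 : (starRingEnd ℂ) 2 = 2 := Complex.conj_ofNat 2
  refine h.isPositive_of_commute (h.isSymmetric_casimir.sub
      ((LinearMap.IsSymmetric.one.sub isSymmetric_scalarPart).smul h2))
    (fun k => (h.commute_casimir k).sub_left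
      (((Commute.one_left _).sub_left (commute_scalarPart_ad _)).smul_left _)) fun n _ hn0 c hn => ?_
  rw [LinearMap.sub_apply, h.casimir_raising_pow, LinearMap.smul_apply, LinearMap.sub_apply,
    Module.End.one_apply] at hn
  rcases eq_or_ne n 0 with rfl | hn'
  · rw [pow_zero] at hn hn0
    rw [scalarPart_one, sub_self, smul_zero, sub_zero] at hn
    have := smul_left_injective ℂ hn0 hn
    simp at this
    exact (Complex.ofReal_eq_zero.mp this.symm).ge
  · rw [h.scalarPart_raising_pow hn', sub_zero, ← sub_smul] at hn
    have h1 := smul_left_injective ℂ hn0 hn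
    have h3 : (n * (n + 1) : ℝ) - 2 = c := by exact_mod_cast h1
    have h4 : (1 : ℝ) ≤ n := by exact_mod_cast Nat.one_le_iff_ne_zero.mpr hn'
    nlinarith

theorem isPositive_sub_casimir [NeZero d] (h : IsAngularMomentum J) :
    (((d * (d - 1) : ℝ) : ℂ) • (1 - scalarPart d) - casimir J).IsPositive := by
  refine h.isPositive_of_commute
    (((LinearMap.IsSymmetric.one.sub isSymmetric_scalarPart).smul (Complex.conj_ofReal _)).sub
      h.isSymmetric_casimir)
    (fun k => (((Commute.one_left _).sub_left (commute_scalarPart_ad _)).smul_left _).sub_left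
      (h.commute_casimir k)) fun n hnd hn0 c hn => ?_
  rw [LinearMap.sub_apply, h.casimir_raising_pow, LinearMap.smul_apply, LinearMap.sub_apply,
    Module.End.one_apply] at hn
  rcases eq_or_ne n 0 with rfl | hn'
  · rw [pow_zero] at hn hn0
    rw [scalarPart_one, sub_self, smul_zero, zero_sub, ← neg_smul] at hn
    have := smul_left_injective ℂ hn0 hn
    simp at this
    exact (Complex.ofReal_eq_zero.mp this.symm).ge
  · rw [h.scalarPart_raising_pow hn', sub_zero, ← sub_smul] at hn
    have h1 := smul_left_injective ℂ hn0 hn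
    have h3 : (d * (d - 1) : ℝ) - n * (n + 1) = c := by exact_mod_cast h1
    have h4 : (n : ℝ) + 1 ≤ d := by exact_mod_cast hnd
    have h5 : (0 : ℝ) ≤ n := n.cast_nonneg
    nlinarith

theorem le_trace_mul_casimir [NeZero d] (h : IsAngularMomentum J) (hC : C.IsPositive)
    (hq : C 1 = (q : ℂ) • (1 : Op d)) :
    2 * ((LinearMap.trace ℂ (Op d) C).re - q) ≤
      (LinearMap.trace ℂ (Op d) (C * casimir J)).re := by
  have h1 := re_trace_mul_nonneg hC h.isPositive_casimir_sub
  rw [mul_sub, mul_smul_comm, mul_sub, mul_one, mul_scalarPart hq] at h1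
  simp [trace_scalarPart] at h1
  linarith

theorem trace_mul_casimir_le [NeZero d] (h : IsAngularMomentum J) (hC : C.IsPositive)
    (hq : C 1 = (q : ℂ) • (1 : Op d)) :
    (LinearMap.trace ℂ (Op d) (C * casimir J)).re ≤
      d * (d - 1) * ((LinearMap.trace ℂ (Op d) C).re - q) := by
  have h1 := re_trace_mul_nonneg hC h.isPositive_sub_casimir
  rw [mul_sub C, mul_smul_comm, mul_sub C, mul_one, mul_scalarPart hq, map_sub, map_smul, map_sub,
    map_smul, trace_scalarPart, Complex.sub_re, smul_eq_mul, Complex.re_ofReal_mul] at h1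
  simp at h1
  linarith

end IsAngularMomentum

end Spectral

/-! ### Isometry invariance of the surface measure. -/

section SphereInvariance

variable {F : Type*} [NormedAddCommGroup F] [InnerProductSpace ℝ F] [FiniteDimensional ℝ F]
  [MeasurableSpace F] [BorelSpace F]

/-- A linear isometry restricted to the unit sphere. -/
def sphereMap (f : F ≃ₗᵢ[ℝ] F) (x : Metric.sphere (0 : F) 1) : Metric.sphere (0 : F) 1 :=
  ⟨f x, by simp⟩

-- Surface measure is, up to a constant, the volume of the cone over a set, and a linear isometry
-- carries cones to cones and preserves volume.
open scoped Pointwise in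
theorem measurePreserving_sphereMap (f : F ≃ₗᵢ[ℝ] F) :
    MeasurePreserving (sphereMap f) (volume : Measure F).toSphere
      (volume : Measure F).toSphere := by
  have hm : Measurable (sphereMap f) :=
    (f.continuous.comp continuous_subtype_val).subtype_mk _ |>.measurable
  refine ⟨hm, Measure.ext fun s hs => ?_⟩
  rw [Measure.map_apply hm hs, Measure.toSphere_apply' _ hs, Measure.toSphere_apply' _ (hm hs)]
  congr 1
  have h1 : Set.Ioo (0 : ℝ) 1 • (Subtype.val '' (sphereMap f ⁻¹' s)) =
      f ⁻¹' (Set.Ioo (0 : ℝ) 1 • (Subtype.val '' s)) := by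
    ext x
    simp only [Set.mem_smul, Set.mem_image, Set.mem_preimage, Subtype.exists, exists_and_right,
      exists_eq_right]
    constructor
    · rintro ⟨r, hr, y, ⟨hy, hys⟩, rfl⟩
      exact ⟨r, hr, f y, ⟨(sphereMap f ⟨y, hy⟩).2, hys⟩, (map_smul f r y).symm⟩
    · rintro ⟨r, hr, y, ⟨hy, hys⟩, hxy⟩
      refine ⟨r, hr, f.symm y, ⟨by simpa using hy, ?_⟩, ?_⟩
      · convert! hys
        simp [sphereMap]
      · rw [← map_smul, hxy, f.symm_apply_apply]
  rw [h1]
  exact (f.measurePreserving).measure_preimage_equiv (f := f.toHomeomorph.toMeasurableEquiv) _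

end SphereInvariance

/-! ### Fourth moments of a random unit vector. -/

variable {d : ℕ}

/-- The uniform probability measure on the unit sphere of `ℂ^d`. -/
noncomputable def sphereMeasure (d : ℕ) :
    Measure (Metric.sphere (0 : EuclideanSpace ℂ (Fin d)) 1) :=
  ((volume : Measure (EuclideanSpace ℂ (Fin d))).toSphere Set.univ)⁻¹ •
    (volume : Measure (EuclideanSpace ℂ (Fin d))).toSphere

instance : IsFiniteMeasure (sphereMeasure d) := by
  unfold sphereMeasure; infer_instance

instance [NeZero d] : IsProbabilityMeasure (sphereMeasure d) := by
  have : Nonempty (Fin d) := ⟨0⟩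
  have : NeZero (volume : Measure (EuclideanSpace ℂ (Fin d))).toSphere :=
    ⟨Measure.toSphere_ne_zero _⟩
  unfold sphereMeasure; infer_instance

theorem pureStateAverage_eq (f : Op d → ℝ) :
    pureStateAverage f = ∫ ψ, f (pureState (ψ : EuclideanSpace ℂ (Fin d))) ∂sphereMeasure d := rfl

theorem integrable_sphereMeasure {g : Metric.sphere (0 : EuclideanSpace ℂ (Fin d)) 1 → ℂ}
    (hg : Continuous g) : Integrable g (sphereMeasure d) :=
  hg.integrable_of_hasCompactSupport (HasCompactSupport.of_compactSpace g)

theorem integral_mulVec_sphereMeasure {A : Op d} (hA : A ∈ Matrix.unitaryGroup (Fin d) ℂ)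
    (g : (Fin d → ℂ) → ℂ) :
    ∫ ψ : Metric.sphere (0 : EuclideanSpace ℂ (Fin d)) 1, g (A *ᵥ ψ.1) ∂sphereMeasure d =
      ∫ ψ : Metric.sphere (0 : EuclideanSpace ℂ (Fin d)) 1, g ψ.1 ∂sphereMeasure d := by
  let T := Matrix.toEuclideanCLM (n := Fin d) (𝕜 := ℂ)
  let u : unitary (EuclideanSpace ℂ (Fin d) →L[ℂ] EuclideanSpace ℂ (Fin d)) :=
    ⟨T A, by
      rw [Unitary.mem_iff, ← map_star, ← map_mul, ← map_mul, (Unitary.mem_iff.mp hA).1,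
        (Unitary.mem_iff.mp hA).2, map_one]
      exact ⟨rfl, rfl⟩⟩
  let e := Unitary.linearIsometryEquiv u
  let f : EuclideanSpace ℂ (Fin d) ≃ₗᵢ[ℝ] EuclideanSpace ℂ (Fin d) :=
    { e.toLinearEquiv.restrictScalars ℝ with norm_map' := e.norm_map }
  have hf : ∀ x, (f x).ofLp = A *ᵥ x.ofLp := fun x => rfl
  have h1 : MeasurePreserving (sphereMap f) (sphereMeasure d) (sphereMeasure d) :=
    (measurePreserving_sphereMap f).smul_measure _
  have h2 : MeasurableEmbedding (sphereMap f) := by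
    have hinv : Function.LeftInverse (sphereMap f.symm) (sphereMap f) := fun x =>
      Subtype.ext (f.symm_apply_apply x)
    have hinv' : Function.RightInverse (sphereMap f.symm) (sphereMap f) := fun x =>
      Subtype.ext (f.apply_symm_apply x)
    exact (MeasurableEquiv.mk ⟨sphereMap f, sphereMap f.symm, hinv, hinv'⟩
      (measurePreserving_sphereMap f).measurable
      (measurePreserving_sphereMap f.symm).measurable).measurableEmbedding
  exact h1.integral_comp h2 fun ψ => g ψ.1

/-- The fourth moments of the uniform measure on the unit sphere. -/
noncomputable def moment (i j k l : Fin d) : ℂ :=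
  ∫ ψ : Metric.sphere (0 : EuclideanSpace ℂ (Fin d)) 1,
    ψ.1 i * star (ψ.1 j) * ψ.1 k * star (ψ.1 l) ∂sphereMeasure d

theorem integrable_moment (i j k l : Fin d) : Integrable
    (fun ψ : Metric.sphere (0 : EuclideanSpace ℂ (Fin d)) 1 =>
      ψ.1 i * star (ψ.1 j) * ψ.1 k * star (ψ.1 l)) (sphereMeasure d) :=
  integrable_sphereMeasure (by fun_prop)

/-- Unitary invariance expanded by multilinearity; the nested sums let a sparse row of `A` be
substituted one index at a time. -/
theorem moment_eq_sum {A : Op d} (hA : A ∈ Matrix.unitaryGroup (Fin d) ℂ) (i j k l : Fin d) :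
    moment i j k l = ∑ p, A i p * ∑ q, star (A j q) * ∑ r, A k r * ∑ s, star (A l s) *
      moment p q r s := by
  have h1 := integral_mulVec_sphereMeasure hA fun x => x i * star (x j) * x k * star (x l)
  have h2 : ∀ x : Fin d → ℂ, (A *ᵥ x) i * star ((A *ᵥ x) j) * (A *ᵥ x) k * star ((A *ᵥ x) l) =
      ∑ p, ∑ q, ∑ r, ∑ s, (A i p * star (A j q) * A k r * star (A l s)) *
        (x p * star (x q) * x r * star (x s)) := by
    intro x
    simp only [Matrix.mulVec, dotProduct, star_sum, star_mul']
    rw [mul_assoc, mul_assoc, Finset.sum_mul]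
    refine Finset.sum_congr rfl fun p _ => ?_
    rw [Finset.sum_mul, Finset.mul_sum]
    refine Finset.sum_congr rfl fun q _ => ?_
    rw [Finset.sum_mul, Finset.mul_sum, Finset.mul_sum]
    refine Finset.sum_congr rfl fun r _ => ?_
    rw [Finset.mul_sum, Finset.mul_sum, Finset.mul_sum]
    refine Finset.sum_congr rfl fun s _ => ?_
    ring
  rw [moment, ← h1]
  simp only [h2]
  have hint : ∀ p q r s (c : ℂ), Integrable (fun ψ :
      Metric.sphere (0 : EuclideanSpace ℂ (Fin d)) 1 => c * (ψ.1 p * star (ψ.1 q) * ψ.1 r * star (ψ.1 s))) (sphereMeasure d) := fun p q r s c =>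
    (integrable_moment p q r s).const_mul c
  simp only [Finset.mul_sum]
  rw [integral_finsetSum _ fun p _ => integrable_finsetSum _ fun q _ =>
    integrable_finsetSum _ fun r _ => integrable_finsetSum _ fun s _ => hint p q r s _]
  refine Finset.sum_congr rfl fun p _ => ?_
  rw [integral_finsetSum _ fun q _ =>
    integrable_finsetSum _ fun r _ => integrable_finsetSum _ fun s _ => hint p q r s _]
  refine Finset.sum_congr rfl fun q _ => ?_
  rw [integral_finsetSum _ fun r _ => integrable_finsetSum _ fun s _ => hint p q r s _]
  refine Finset.sum_congr rfl fun r _ => ?_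
  rw [integral_finsetSum _ fun s _ => hint p q r s _]
  refine Finset.sum_congr rfl fun s _ => ?_
  rw [integral_const_mul, moment]
  ring

/-- Multiplying one coordinate by i is unitary, and unless the indices pair up some coordinate gives
the moment a factor other than 1. A sign flip would not suffice: it cannot detect ψ_i² ψ̄_j². -/
theorem moment_eq_zero {i j k l : Fin d} (h1 : ¬(i = j ∧ k = l)) (h2 : ¬(i = l ∧ k = j)) :
    moment i j k l = 0 := by
  have key : ∀ a : Fin d, moment i j k l = (if i = a then Complex.I else 1) *
      ((if j = a then -Complex.I else 1) * ((if k = a then Complex.I else 1) *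
        ((if l = a then -Complex.I else 1) * moment i j k l))) := by
    intro a
    have hA : Matrix.diagonal (fun i => if i = a then Complex.I else 1) ∈
        Matrix.unitaryGroup (Fin d) ℂ := by
      rw [Matrix.mem_unitaryGroup_iff, Matrix.star_eq_conjTranspose,
        Matrix.diagonal_conjTranspose, Matrix.diagonal_mul_diagonal, ← Matrix.diagonal_one]
      congr 1
      ext p
      by_cases hp : p = a <;> simp [hp]
    conv_lhs => rw [moment_eq_sum hA]
    simp [Matrix.diagonal_apply, ite_mul, apply_ite (starRingEnd ℂ)]
  have hI : ∀ c : ℂ, c ≠ 1 → moment i j k l = c * moment i j k l → moment i j k l = 0 := by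
    intro c hc h
    have : (c - 1) * moment i j k l = 0 := by linear_combination -h
    exact (mul_eq_zero.mp this).resolve_left (sub_ne_zero.mpr hc)
  have hI1 : Complex.I ≠ 1 := fun h => by simpa using congrArg Complex.re h
  have hI2 : (-1 : ℂ) ≠ 1 := by norm_num
  have hki := key i
  have hkk := key k
  by_cases hij : i = j
  · subst hij
    have hkl : k ≠ l := fun h => h1 ⟨rfl, h⟩
    apply hI _ hI1
    by_cases hik : i = k
    · subst hik
      simpa [hkl.symm, ← mul_assoc] using hkk
    · simpa [hkl.symm, hik] using hkk
  · by_cases hil : i = l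
    · subst hil
      have hkj : k ≠ j := fun h => h2 ⟨rfl, h⟩
      apply hI _ hI1
      by_cases hik : i = k
      · subst hik
        simpa [hij, Ne.symm hij, ← mul_assoc] using hkk
      · simpa [hkj.symm, hik] using hkk
    · by_cases hik : i = k
      · subst hik
        apply hI _ hI2
        simpa [Ne.symm hij, Ne.symm hil, ← mul_assoc] using hki
      · apply hI _ hI1
        simpa [Ne.symm hij, Ne.symm hil, Ne.symm hik] using hki

theorem moment_comm_right (i j k l : Fin d) : moment i j k l = moment i l k j := by
  simp only [moment]
  congr 1
  ext ψ
  ring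

theorem moment_comm_left (i j k l : Fin d) : moment i j k l = moment k j i l := by
  simp only [moment]
  congr 1
  ext ψ
  ring

/-- The reflection of `ℂ^d` along the unit vector `(3 e_a + 4 e_b) / 5`. -/
noncomputable def coordinateReflection (a b : Fin d) : Op d :=
  1 - (2 : ℂ) • Matrix.vecMulVec (Pi.single a (3 / 5) + Pi.single b (4 / 5))
    (Pi.single a (3 / 5) + Pi.single b (4 / 5))

theorem coordinateReflection_mem {a b : Fin d} (hab : a ≠ b) :
    coordinateReflection a b ∈ Matrix.unitaryGroup (Fin d) ℂ := by
  set v : Fin d → ℂ := Pi.single a (3 / 5) + Pi.single b (4 / 5) with hv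
  have hvv : v ⬝ᵥ v = 1 := by
    simp [hv, hab, Ne.symm hab]
    norm_num
  have hstar : star v = v := by
    ext p
    simp [hv, Pi.single_apply, apply_ite (starRingEnd ℂ), map_ofNat]
  have hself : star (coordinateReflection a b) = coordinateReflection a b := by
    rw [coordinateReflection, ← hv, Matrix.star_eq_conjTranspose, Matrix.conjTranspose_sub,
      Matrix.conjTranspose_smul, Matrix.conjTranspose_vecMulVec, hstar]
    simp
  rw [Matrix.mem_unitaryGroup_iff, hself, coordinateReflection, ← hv, sub_mul, mul_sub, mul_sub,
    smul_mul_smul_comm, Matrix.vecMulVec_mul_vecMulVec, hvv]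
  simp only [one_mul, mul_one, one_smul]
  module

theorem coordinateReflection_left {a b : Fin d} (hab : a ≠ b) :
    coordinateReflection a b a = Pi.single a (7 / 25) + Pi.single b (-24 / 25) := by
  ext p
  by_cases hpa : p = a
  · subst hpa
    simp [coordinateReflection, Matrix.vecMulVec_apply, hab]
    norm_num
  · by_cases hpb : p = b
    · subst hpb
      simp [coordinateReflection, Matrix.vecMulVec_apply, hab, Ne.symm hab]
      norm_num
    · simp [coordinateReflection, Matrix.vecMulVec_apply, hpa, hpb, Ne.symm hpa]

theorem coordinateReflection_right {a b : Fin d} (hab : a ≠ b) :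
    coordinateReflection a b b = Pi.single a (-24 / 25) + Pi.single b (-7 / 25) := by
  ext p
  by_cases hpa : p = a
  · subst hpa
    simp [coordinateReflection, Matrix.vecMulVec_apply, Ne.symm hab]
    norm_num
  · by_cases hpb : p = b
    · subst hpb
      simp [coordinateReflection, Matrix.vecMulVec_apply, Ne.symm hab]
      norm_num
    · simp [coordinateReflection, Matrix.vecMulVec_apply, hpa, hpb, Ne.symm hpb]

/-- Of the sixteen terms, those of odd degree in `a` vanish, as do abab and baba; the four remaining
mixed ones coincide. -/
theorem moment_of_row {a b c : Fin d} (hab : a ≠ b) {A : Op d}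
    (hA : A ∈ Matrix.unitaryGroup (Fin d) ℂ) {x y : ℝ}
    (hrow : A c = Pi.single a (x : ℂ) + Pi.single b (y : ℂ)) :
    moment c c c c = x ^ 4 * moment a a a a + y ^ 4 * moment b b b b +
      4 * x ^ 2 * y ^ 2 * moment a a b b := by
  have hsum : ∀ F : Fin d → ℂ, ∑ p, A c p * F p = x * F a + y * F b := by
    intro F
    simp [hrow, add_mul, Finset.sum_add_distrib, Pi.single_apply]
  have hsum' : ∀ F : Fin d → ℂ, ∑ p, star (A c p) * F p = x * F a + y * F b := by
    intro F
    simp [hrow, add_mul, Finset.sum_add_distrib, Pi.single_apply, apply_ite (starRingEnd ℂ)]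
  have hz : ∀ i j k l : Fin d, ¬(i = j ∧ k = l) → ¬(i = l ∧ k = j) → moment i j k l = 0 :=
    fun i j k l => moment_eq_zero
  rw [moment_eq_sum hA]
  simp only [hsum, hsum']
  rw [hz a a a b, hz a a b a, hz a b a a, hz b a a a, hz b b b a, hz b b a b, hz b a b b,
    hz a b b b, hz a b a b, hz b a b a, moment_comm_right a b b a, moment_comm_right b a a b,
    moment_comm_left b b a a, moment_comm_right a b b a]
  · ring
  all_goals simp [hab, Ne.symm hab]

/-- Rows `a` and `b` of the reflection give two linear equations: their difference equates the two
pure moments, and the first then yields the mixed one. The 3-4-5 triangle keeps coefficients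
rational. -/
theorem moment_self_eq {a b : Fin d} (hab : a ≠ b) :
    moment a a a a = moment b b b b ∧ moment a a b b = moment a a a a / 2 := by
  have h1 := moment_of_row hab (coordinateReflection_mem hab) (x := 7 / 25) (y := -24 / 25)
    (by rw [coordinateReflection_left hab]; norm_num)
  have h2 := moment_of_row hab (coordinateReflection_mem hab) (x := -24 / 25) (y := -7 / 25)
    (by rw [coordinateReflection_right hab]; norm_num)
  push_cast at h1 h2
  have h3 : moment a a a a = moment b b b b := by
    linear_combination (h1 - h2) / (1 - ((7 / 25) ^ 4 - (24 / 25) ^ 4))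
  refine ⟨h3, ?_⟩
  rw [← h3] at h1
  linear_combination (-h1) / (4 * (7 / 25) ^ 2 * (24 / 25) ^ 2)

theorem sum_mul_star_eq_one (ψ : Metric.sphere (0 : EuclideanSpace ℂ (Fin d)) 1) :
    ∑ i, ψ.1 i * star (ψ.1 i) = 1 := by
  have h3 : ‖ψ.1‖ = 1 := by simp
  rw [EuclideanSpace.norm_eq, Real.sqrt_eq_one] at h3
  have h4 : ∀ z : ℂ, z * star z = ((‖z‖ ^ 2 : ℝ) : ℂ) := fun z => by
    rw [Complex.star_def, Complex.mul_conj']; simp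
  simp only [h4]
  exact_mod_cast h3

theorem sum_moment [NeZero d] : ∑ i : Fin d, ∑ k : Fin d, moment i i k k = 1 := by
  have h1 : ∀ ψ : Metric.sphere (0 : EuclideanSpace ℂ (Fin d)) 1,
      ∑ i, ∑ k, ψ.1 i * star (ψ.1 i) * ψ.1 k * star (ψ.1 k) = 1 := by
    intro ψ
    have h2 := sum_mul_star_eq_one ψ
    calc _ = (∑ i, ψ.1 i * star (ψ.1 i)) * ∑ k, ψ.1 k * star (ψ.1 k) := by
          rw [Finset.sum_mul_sum]
          simp only [mul_assoc]
      _ = 1 := by rw [h2, one_mul]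
  have h5 : ∫ ψ : Metric.sphere (0 : EuclideanSpace ℂ (Fin d)) 1,
      ∑ i, ∑ k, ψ.1 i * star (ψ.1 i) * ψ.1 k * star (ψ.1 k) ∂sphereMeasure d =
        ∑ i : Fin d, ∑ k : Fin d, moment i i k k := by
    rw [integral_finsetSum _ fun i _ => integrable_finsetSum _ fun k _ => integrable_moment i i k k]
    refine Finset.sum_congr rfl fun i _ => ?_
    rw [integral_finsetSum _ fun k _ => integrable_moment i i k k]
    rfl
  rw [← h5]
  simp only [h1]
  simp

theorem moment_eq [NeZero d] (i j k l : Fin d) :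
    moment i j k l = ((if i = j ∧ k = l then 1 else 0) + (if i = l ∧ k = j then 1 else 0)) /
      ((d : ℂ) * (d + 1)) := by
  have hd : (d : ℂ) ≠ 0 := by exact_mod_cast NeZero.ne d
  have hd1 : (d : ℂ) + 1 ≠ 0 := by exact_mod_cast d.succ_ne_zero
  set m : ℂ := moment (0 : Fin d) 0 0 0 with hm
  have hdiag : ∀ a : Fin d, moment a a a a = m := by
    intro a
    by_cases ha : a = 0
    · rw [ha]
    · exact (moment_self_eq ha).1
  have hpair : ∀ a b : Fin d, moment a a b b = (m / 2) * (1 + if a = b then 1 else 0) := by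
    intro a b
    by_cases hab : a = b
    · subst hab
      rw [hdiag, if_pos rfl]; ring
    · rw [(moment_self_eq hab).2, hdiag, if_neg hab]; ring
  have hmval : m / 2 = 1 / ((d : ℂ) * (d + 1)) := by
    have h1 := sum_moment (d := d)
    simp only [hpair, ← Finset.mul_sum, Finset.sum_add_distrib] at h1
    simp at h1
    field_simp
    linear_combination 2 * h1
  by_cases h1 : i = j ∧ k = l
  · obtain ⟨rfl, rfl⟩ := h1
    rw [hpair, hmval]
    by_cases hik : i = k
    · simp only [hik, and_self, if_true]
      field_simp
    · simp [hik]
  · by_cases h2 : i = l ∧ k = j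
    · obtain ⟨rfl, rfl⟩ := h2
      rw [moment_comm_right, hpair, hmval]
      have hik : i ≠ k := fun h => h1 ⟨h, h.symm⟩
      simp [hik]
    · rw [moment_eq_zero h1 h2, if_neg h1, if_neg h2]
      simp

/-! ### Averages over pure states. -/

section Averages

variable {d : ℕ}

theorem pureState_eq_sum (ψ : EuclideanSpace ℂ (Fin d)) :
    pureState ψ = ∑ i, ∑ k, (ψ i * star (ψ k)) • Matrix.single i k (1 : ℂ) := by
  conv_lhs => rw [Matrix.matrix_eq_sum_single (pureState ψ)]
  simp [pureState, Matrix.smul_single]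

theorem continuous_bilin_pureState (B : Op d →ₗ[ℂ] Op d →ₗ[ℂ] ℂ) :
    Continuous fun ψ : Metric.sphere (0 : EuclideanSpace ℂ (Fin d)) 1 =>
      B (pureState ψ.1) (pureState ψ.1) := by
  simp only [pureState_eq_sum, map_sum, map_smul, LinearMap.sum_apply, LinearMap.smul_apply,
    smul_eq_mul]
  fun_prop

/-- The two pairings in `moment_eq` are the identity and the swap; they give the two summands. -/
theorem integral_bilin_pureState [NeZero d] (B : Op d →ₗ[ℂ] Op d →ₗ[ℂ] ℂ) :
    ∫ ψ : Metric.sphere (0 : EuclideanSpace ℂ (Fin d)) 1,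
        B (pureState ψ.1) (pureState ψ.1) ∂sphereMeasure d =
      (B 1 1 + ∑ i, ∑ k, B (Matrix.single i k 1) (Matrix.single k i 1)) / (d * (d + 1)) := by
  have h1 : ∀ ψ : Metric.sphere (0 : EuclideanSpace ℂ (Fin d)) 1,
      B (pureState ψ.1) (pureState ψ.1) = ∑ i, ∑ j, ∑ k, ∑ l,
        B (Matrix.single i j 1) (Matrix.single k l 1) *
          (ψ.1 i * star (ψ.1 j) * ψ.1 k * star (ψ.1 l)) := by
    intro ψ
    have hl : ∀ Y, B (pureState ψ.1) Y =
        ∑ i, ∑ j, (ψ.1 i * star (ψ.1 j)) * B (Matrix.single i j 1) Y := by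
      intro Y
      simp only [pureState_eq_sum, map_sum, map_smul, LinearMap.sum_apply, LinearMap.smul_apply,
        smul_eq_mul]
    have hr : ∀ X, B X (pureState ψ.1) =
        ∑ k, ∑ l, (ψ.1 k * star (ψ.1 l)) * B X (Matrix.single k l 1) := by
      intro X
      simp only [pureState_eq_sum, map_sum, map_smul, smul_eq_mul]
    rw [hl]
    refine Finset.sum_congr rfl fun i _ => Finset.sum_congr rfl fun j _ => ?_
    rw [hr, Finset.mul_sum]
    refine Finset.sum_congr rfl fun k _ => ?_
    rw [Finset.mul_sum]
    refine Finset.sum_congr rfl fun l _ => ?_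
    ring
  have hint : ∀ i j k l (c : ℂ), Integrable (fun ψ :
      Metric.sphere (0 : EuclideanSpace ℂ (Fin d)) 1 =>
        c * (ψ.1 i * star (ψ.1 j) * ψ.1 k * star (ψ.1 l))) (sphereMeasure d) := fun i j k l c =>
    (integrable_moment i j k l).const_mul c
  have h2 : ∫ ψ : Metric.sphere (0 : EuclideanSpace ℂ (Fin d)) 1,
      B (pureState ψ.1) (pureState ψ.1) ∂sphereMeasure d = ∑ i, ∑ j, ∑ k, ∑ l,
        B (Matrix.single i j 1) (Matrix.single k l 1) * moment i j k l := by
    simp only [h1]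
    rw [integral_finsetSum _ fun i _ => integrable_finsetSum _ fun j _ =>
      integrable_finsetSum _ fun k _ => integrable_finsetSum _ fun l _ => hint i j k l _]
    refine Finset.sum_congr rfl fun i _ => ?_
    rw [integral_finsetSum _ fun j _ =>
      integrable_finsetSum _ fun k _ => integrable_finsetSum _ fun l _ => hint i j k l _]
    refine Finset.sum_congr rfl fun j _ => ?_
    rw [integral_finsetSum _ fun k _ => integrable_finsetSum _ fun l _ => hint i j k l _]
    refine Finset.sum_congr rfl fun k _ => ?_
    rw [integral_finsetSum _ fun l _ => hint i j k l _]
    refine Finset.sum_congr rfl fun l _ => ?_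
    rw [integral_const_mul, moment]
  have hone : (1 : Op d) = ∑ i, Matrix.single i i 1 := by
    ext a b
    simp [Matrix.sum_apply, Matrix.single_apply, Matrix.one_apply, ite_and]
  rw [h2, hone]
  simp only [map_sum, LinearMap.sum_apply, moment_eq, mul_div_assoc', ← Finset.sum_div]
  congr 1
  simp only [mul_add, Finset.sum_add_distrib, ite_and, mul_ite, mul_one, mul_zero,
    Finset.sum_ite_eq, Finset.mem_univ, if_true, Finset.sum_ite_irrel, Finset.sum_const_zero]
  congr 1
  · exact Finset.sum_comm
  · simp

theorem isHermitian_pureState (ψ : EuclideanSpace ℂ (Fin d)) : (pureState ψ).IsHermitian := by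
  ext i k
  simp [pureState, mul_comm]

theorem trace_pureState (ψ : Metric.sphere (0 : EuclideanSpace ℂ (Fin d)) 1) :
    (pureState ψ.1).trace = 1 :=
  sum_mul_star_eq_one ψ

theorem integral_re_bilin_pureState [NeZero d] (B : Op d →ₗ[ℂ] Op d →ₗ[ℂ] ℂ) :
    ∫ ψ : Metric.sphere (0 : EuclideanSpace ℂ (Fin d)) 1,
        (B (pureState ψ.1) (pureState ψ.1)).re ∂sphereMeasure d =
      (B 1 1 + ∑ i, ∑ k, B (Matrix.single i k 1) (Matrix.single k i 1)).re / (d * (d + 1)) := by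
  have h1 := integral_re (integrable_sphereMeasure (continuous_bilin_pureState B))
  rw [integral_bilin_pureState] at h1
  refine h1.trans ?_
  have h2 : ((d : ℂ) * (d + 1)) = ((d * (d + 1) : ℝ) : ℂ) := by push_cast; ring
  rw [h2]
  exact Complex.div_ofReal_re _ _

/-- The bilinear form `(X, Y) ↦ tr (F(X) F(Y))`. -/
def traceForm (F : Op d →ₗ[ℂ] Op d) : Op d →ₗ[ℂ] Op d →ₗ[ℂ] ℂ :=
  LinearMap.mk₂ ℂ (fun X Y => (F X * F Y).trace) (by simp [add_mul]) (by simp)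
    (by simp [mul_add]) (by simp)

theorem traceForm_apply (F : Op d →ₗ[ℂ] Op d) (X Y : Op d) :
    traceForm F X Y = (F X * F Y).trace := rfl

theorem unitarity_eq [NeZero d] (hd : 1 < d) {E : Op d →ₗ[ℂ] Op d}
    (hE : ∀ X, (E X).trace = X.trace) (h1 : E 1 = 1) :
    unitarity E = ((LinearMap.trace ℂ (Op d) (choi E * choi E)).re - 1) / ((d : ℝ) ^ 2 - 1) := by
  -- Pure states have trace one, so E(ψ − 1/d) = F(ψ) with F linear. F kills the identity, so only
  -- the swap term survives.
  set F : Op d →ₗ[ℂ] Op d := E * (1 - scalarPart d) with hF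
  have hd0 : (d : ℂ) ≠ 0 := by exact_mod_cast NeZero.ne d
  have hFX : ∀ X, F X = E X - (X.trace * (d : ℂ)⁻¹) • (1 : Op d) := by
    intro X
    rw [hF, Module.End.mul_apply, LinearMap.sub_apply, Module.End.one_apply, map_sub,
      scalarPart_apply, map_smul, map_smul, h1, smul_smul]
  have hav : pureStateAverage (fun ψ => ((E (ψ - (d : ℂ)⁻¹ • (1 : Op d)) ^ 2).trace).re) =
      ∫ ψ : Metric.sphere (0 : EuclideanSpace ℂ (Fin d)) 1,
        (traceForm F (pureState ψ.1) (pureState ψ.1)).re ∂sphereMeasure d := by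
    rw [pureStateAverage_eq]
    congr 1
    ext ψ
    rw [traceForm_apply, ← sq, hFX, trace_pureState, one_mul, map_sub, map_smul, h1]
  have hF1 : F 1 = 0 := by
    rw [hFX, Matrix.trace_one, Fintype.card_fin, mul_inv_cancel₀ hd0, one_smul, h1, sub_self]
  have hterm : ∀ i k : Fin d, traceForm F (Matrix.single i k 1) (Matrix.single k i 1) =
      (E (Matrix.single i k 1) * E (Matrix.single k i 1)).trace -
        if i = k then (d : ℂ)⁻¹ else 0 := by
    intro i k
    rw [traceForm_apply, hFX, hFX]
    simp only [sub_mul, mul_sub, smul_mul_assoc, mul_smul_comm, one_mul, mul_one,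
      Matrix.trace_sub, Matrix.trace_smul, hE, Matrix.trace_one, Fintype.card_fin, smul_eq_mul]
    by_cases hik : i = k
    · subst hik
      simp
    · simp [Matrix.trace_single_eq_of_ne, hik, Ne.symm hik]
  have hsum : traceForm F 1 1 + ∑ i, ∑ k, traceForm F (Matrix.single i k 1) (Matrix.single k i 1) =
      LinearMap.trace ℂ (Op d) (choi E * choi E) - 1 := by
    rw [traceForm_apply, hF1, zero_mul, Matrix.trace_zero, zero_add, trace_choi_mul_self]
    simp [hterm, Finset.sum_sub_distrib, hd0]
  rw [unitarity, hav, integral_re_bilin_pureState, hsum]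
  have h2 : (1 : ℝ) < d := by exact_mod_cast hd
  have h3 : (d : ℝ) - 1 ≠ 0 := by linarith
  have h4 : (d : ℝ) + 1 ≠ 0 := by linarith
  have h5 : (d : ℝ) ^ 2 - 1 = (d - 1) * (d + 1) := by ring
  rw [h5]
  simp only [Complex.sub_re, Complex.one_re]
  field_simp

theorem IsAngularMomentum.trace_eq_zero {J : Fin 3 → Op d} (h : IsAngularMomentum J) (k : Fin 3) :
    (J k).trace = 0 := by
  have h1 := congrArg Matrix.trace (h.commutator (k + 1))
  rw [Matrix.trace_sub, Matrix.trace_mul_comm, sub_self, Matrix.trace_smul, add_assoc,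
    show (1 : Fin 3) + 2 = 0 from rfl, add_zero] at h1
  simpa using h1.symm

/-- Each deviation is (c − 1) tr (ψ J_k), with a real trace. The identity term vanishes as J_k is
traceless, and the swap term is tr Σ J_k² = d(d² − 1)/4, to be divided by d(d + 1). -/
theorem averageTotalDeviation_eq [NeZero d] {J : Fin 3 → Op d} (h : IsAngularMomentum J)
    {E : Op d →ₗ[ℂ] Op d} {c : ℝ} (hE : ∀ k X, (E X * J k).trace = c * (X * J k).trace) :
    averageTotalDeviation J E = (1 - c) ^ 2 * ((d : ℝ) - 1) / 4 := by
  have hd0 : (d : ℝ) ≠ 0 := by exact_mod_cast NeZero.ne d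
  have hd1 : (d : ℝ) + 1 ≠ 0 := by exact_mod_cast d.succ_ne_zero
  let L : Fin 3 → Op d →ₗ[ℂ] ℂ := fun k =>
    Matrix.traceLinearMap (Fin d) ℂ ℂ ∘ₗ LinearMap.mulRight ℂ (J k)
  have hL : ∀ k X, L k X = (X * J k).trace := fun _ _ => rfl
  let B : Op d →ₗ[ℂ] Op d →ₗ[ℂ] ℂ := (((1 - c) ^ 2 : ℝ) : ℂ) •
    ∑ k, LinearMap.mk₂ ℂ (fun X Y => L k X * L k Y) (by intros; simp [add_mul])
      (by intros; simp [mul_assoc]) (by intros; simp [mul_add])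
      (by intros; simp [mul_left_comm])
  have hB : ∀ X Y, B X Y = (((1 - c) ^ 2 : ℝ) : ℂ) * ∑ k, L k X * L k Y := fun X Y => by
    simp [B, LinearMap.sum_apply]
  have hav : averageTotalDeviation J E =
      ∫ ψ : Metric.sphere (0 : EuclideanSpace ℂ (Fin d)) 1,
        (B (pureState ψ.1) (pureState ψ.1)).re ∂sphereMeasure d := by
    rw [averageTotalDeviation, pureStateAverage_eq]
    congr 1
    ext ψ
    rw [totalDeviation, hB, Complex.re_ofReal_mul, Complex.re_sum, Finset.mul_sum]
    refine Finset.sum_congr rfl fun k _ => ?_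
    have him : (L k (pureState ψ.1)).im = 0 := by
      rw [← Complex.conj_eq_iff_im, hL, starRingEnd_apply, ← Matrix.trace_conjTranspose,
        Matrix.conjTranspose_mul, (h.hermitian k).eq, (isHermitian_pureState _).eq,
        Matrix.trace_mul_comm]
    rw [directionalDeviation, Matrix.trace_sub, hE, ← hL, Complex.mul_re, him, ← Complex.normSq_eq_norm_sq,
      Complex.normSq_apply]
    simp [him]
    ring
  have hsum : B 1 1 + ∑ i, ∑ k, B (Matrix.single i k 1) (Matrix.single k i 1) =
      (((1 - c) ^ 2 * (d * ((d : ℝ) ^ 2 - 1) / 4) : ℝ) : ℂ) := by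
    have h1 : B 1 1 = 0 := by simp [hB, hL, h.trace_eq_zero]
    have h2 : ∀ (i k : Fin d) (a : Fin 3), L a (Matrix.single i k 1) = J a k i := by
      intro i k a
      rw [hL, Matrix.trace_mul_comm, Matrix.trace_mul_single]
      simp
    have h3 : ∑ i, ∑ k, ∑ a, J a k i * J a i k = (d : ℂ) * ((d : ℂ) ^ 2 - 1) / 4 := by
      have h4 := congrArg Matrix.trace h.sum_sq
      rw [Matrix.trace_sum, Matrix.trace_smul, Matrix.trace_one, Fintype.card_fin] at h4
      have h5 : ∑ i, ∑ k, ∑ a, J a k i * J a i k = ∑ a, (J a * J a).trace := by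
        simp only [Matrix.trace, Matrix.diag_apply, Matrix.mul_apply]
        rw [Finset.sum_comm]
        simp only [Finset.sum_comm (s := (Finset.univ : Finset (Fin 3)))]
      rw [h5, h4, smul_eq_mul]
      ring
    simp only [h1, hB, h2, ← Finset.mul_sum, h3, zero_add]
    push_cast
    ring
  rw [hav, integral_re_bilin_pureState, hsum, Complex.ofReal_re]
  field_simp
  ring

end Averages

/-! ### The Heisenberg picture on the generators. -/

section Dual

variable {d : ℕ}

/-- The dual (Heisenberg picture) map. -/
noncomputable def dualMap (E : Op d →ₗ[ℂ] Op d) (Y : Op d) : Op d :=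
  Matrix.of fun a b => (E (Matrix.single b a 1) * Y).trace

theorem trace_mul_dualMap (E : Op d →ₗ[ℂ] Op d) (X Y : Op d) :
    (X * dualMap E Y).trace = (E X * Y).trace := by
  rw [map_eq_sum E X]
  simp only [Finset.sum_mul, Matrix.trace_sum, smul_mul_assoc, Matrix.trace_smul, smul_eq_mul]
  simp [Matrix.trace, Matrix.mul_apply, dualMap]

theorem trace_mul_commutator (A X Y : Op d) :
    (X * (A * Y - Y * A)).trace = -((A * X - X * A) * Y).trace := by
  rw [mul_sub, sub_mul, Matrix.trace_sub, Matrix.trace_sub, ← mul_assoc, ← mul_assoc,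
    Matrix.trace_mul_comm (X * Y) A, mul_assoc A X]
  ring

theorem trace_map_mul_commutator {E : Op d →ₗ[ℂ] Op d} {A : Op d}
    (hE : ∀ X, E (A * X - X * A) = A * E X - E X * A) (X Y : Op d) :
    (E X * (A * Y - Y * A)).trace = -(E (A * X - X * A) * Y).trace := by
  rw [trace_mul_commutator, hE]

theorem dualMap_commutator {E : Op d →ₗ[ℂ] Op d} {A : Op d}
    (hE : ∀ X, E (A * X - X * A) = A * E X - E X * A) (Y : Op d) :
    A * dualMap E Y - dualMap E Y * A = dualMap E (A * Y - Y * A) := by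
  refine Matrix.ext_iff_trace_mul_left.mpr fun X => ?_
  rw [trace_mul_dualMap, trace_map_mul_commutator hE, trace_mul_commutator, trace_mul_dualMap]

/-- The dual map commutes with the adjoint action, so it sends J₊ to zero or to a highest weight
vector of weight one, in either case a multiple of J₊. Commutators pass the same factor on to J₂,
then to J₀ and J₁. -/
theorem IsAngularMomentum.exists_trace_map_mul [NeZero d] {J : Fin 3 → Op d}
    (h : IsAngularMomentum J) {E : Op d →ₗ[ℂ] Op d}
    (hE : ∀ k X, E (J k * X - X * J k) = J k * E X - E X * J k) :
    ∃ c : ℂ, ∀ k X, (E X * J k).trace = c * (X * J k).trace := by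
  obtain ⟨w, hw⟩ := h.exists_isLowestWeight
  have hEP : ∀ X, E (raising J * X - X * raising J) = raising J * E X - E X * raising J := by
    intro X
    have h1 : ∀ Y : Op d, raising J * Y - Y * raising J =
        (J 0 * Y - Y * J 0) + Complex.I • (J 1 * Y - Y * J 1) := fun Y => by
      simp only [raising, add_mul, mul_add, smul_mul_assoc, mul_smul_comm, smul_sub]; abel
    rw [h1, h1, map_add, map_smul, hE, hE]
  obtain ⟨c, hc⟩ : ∃ c : ℂ, dualMap E (raising J) = c • raising J := by
    by_cases h0 : dualMap E (raising J) = 0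
    · exact ⟨0, by rw [h0, zero_smul]⟩
    have h1 := dualMap_commutator hEP (raising J)
    have h2 : dualMap E (0 : Op d) = 0 := by ext; simp [dualMap]
    rw [sub_self, h2] at h1
    have h3 := dualMap_commutator (hE 2) (raising J)
    rw [h.commutator_raising] at h3
    obtain ⟨n, -, hn, c, hc⟩ := hw.exists_eq_smul_pow h0 h1 (μ := 1) (by rw [h3, one_smul])
    obtain rfl : n = 1 := by exact_mod_cast hn.symm
    exact ⟨c, by rw [hc, pow_one]⟩
  have hP : ∀ X, (E X * raising J).trace = c * (X * raising J).trace := fun X => by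
    rw [← trace_mul_dualMap, hc, mul_smul_comm, Matrix.trace_smul, smul_eq_mul]
  have hstep : ∀ (k : Fin 3) (Y Y' : Op d) (z : ℂ), z ≠ 0 → J k * Y - Y * J k = z • Y' →
      (∀ X, (E X * Y).trace = c * (X * Y).trace) → ∀ X, (E X * Y').trace = c * (X * Y').trace := by
    intro k Y Y' z hz hY hc X
    have h1 : (E X * (J k * Y - Y * J k)).trace = c * (X * (J k * Y - Y * J k)).trace := by
      rw [trace_map_mul_commutator (hE k), hc, trace_mul_commutator]; ring
    rw [hY, mul_smul_comm, mul_smul_comm, Matrix.trace_smul, Matrix.trace_smul, smul_eq_mul,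
      smul_eq_mul, mul_left_comm] at h1
    exact mul_left_cancel₀ hz h1
  have h01 := h.commutator 0
  have h12 := h.commutator 1
  have h20 := h.commutator 2
  simp only [Fin.isValue, Fin.reduceAdd] at h01 h12 h20
  have hJ2 := hstep 0 (raising J) (J 2) (-1) (by norm_num) (by
    have : J 0 * raising J - raising J * J 0 = Complex.I • (J 0 * J 1 - J 1 * J 0) := by
      simp only [raising, add_mul, mul_add, smul_mul_assoc, mul_smul_comm, smul_sub]; abel
    rw [this, h01, smul_smul, Complex.I_mul_I]) hP
  have hJ0 := hstep 1 (J 2) (J 0) Complex.I Complex.I_ne_zero h12 hJ2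
  have hJ1 := hstep 0 (J 2) (J 1) (-Complex.I) (neg_ne_zero.mpr Complex.I_ne_zero)
    (by rw [neg_smul, ← h20, neg_sub]) hJ2
  refine ⟨c, fun k => ?_⟩
  fin_cases k
  exacts [hJ0, hJ1, hJ2]

end Dual

/-! ### Assembling the bounds. -/

section Conclusion

variable {d : ℕ} {J : Fin 3 → Op d} {E : Op d →ₗ[ℂ] Op d}

attribute [local instance] hilbertSchmidtNormedAddCommGroup
attribute [local instance] hilbertSchmidtInnerProductSpace

/-- The double commutators expand to the scalar Σ J_k² on each side minus 2 Σ J_k X J_k, and C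
paired with the latter gives Σ tr (E(J_k) J_k) = c tr Σ J_k². -/
theorem IsAngularMomentum.trace_choi_mul_casimir [NeZero d] (h : IsAngularMomentum J)
    (hE : ∀ X, (E X).trace = X.trace) {c : ℂ}
    (hc : ∀ k X, (E X * J k).trace = c * (X * J k).trace) :
    LinearMap.trace ℂ (Op d) (choi E * casimir J) = d * ((d : ℂ) ^ 2 - 1) / 2 * (1 - c) := by
  have h1 : casimir J = (((d : ℂ) ^ 2 - 1) / 2) • (1 : Module.End ℂ (Op d)) -
      (2 : ℂ) • ∑ k, LinearMap.mulLeft ℂ (J k) * LinearMap.mulRight ℂ (J k) := by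
    ext1 X
    have h2 : ∀ k, ad (J k) (ad (J k) X) = (J k * J k) * X + X * (J k * J k) -
        (2 : ℂ) • (J k * X * J k) := fun k => by
      rw [two_smul]; simp only [ad_apply]; noncomm_ring
    simp only [casimir, LinearMap.sum_apply, Module.End.mul_apply, h2, Finset.sum_sub_distrib,
      Finset.sum_add_distrib, ← Finset.sum_mul, ← Finset.mul_sum, h.sum_sq, LinearMap.sub_apply,
      LinearMap.smul_apply, Module.End.one_apply, LinearMap.mulLeft_apply,
      LinearMap.mulRight_apply, ← Finset.smul_sum, smul_mul_assoc, mul_smul_comm, one_mul, mul_one]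
    simp only [mul_assoc]
    module
  have h3 : ∑ k, (E (J k) * J k).trace = c * (d * ((d : ℂ) ^ 2 - 1) / 4) := by
    simp only [hc, ← Finset.mul_sum, ← Matrix.trace_sum, h.sum_sq, Matrix.trace_smul,
      Matrix.trace_one, Fintype.card_fin, smul_eq_mul]
    ring
  rw [h1, mul_sub, mul_smul_comm, mul_smul_comm, mul_one, Finset.mul_sum, map_sub, map_smul,
    map_smul, map_sum, trace_choi, hE, Matrix.trace_one, Fintype.card_fin]
  simp only [trace_choi_mul, h3, smul_eq_mul]
  ring

theorem IsAngularMomentum.exists_choi_one [NeZero d] (h : IsAngularMomentum J)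
    (hE : IsQuantumChannel E) (hc : ∀ k, Commute (choi E) (ad (J k))) :
    ∃ q : ℝ, 0 ≤ q ∧ choi E 1 = (q : ℂ) • (1 : Op d) := by
  obtain ⟨z, hz⟩ := h.exists_eq_smul_one (X := choi E 1) fun k => by
    have := LinearMap.congr_fun (hc k).eq 1
    simpa using this.symm
  have h1 := (isPositive_choi hE).inner_nonneg_right 1
  have hd : (0 : ℝ) < d := by exact_mod_cast NeZero.pos d
  rw [hz, hilbertSchmidt_inner, Matrix.conjTranspose_one, one_mul, Matrix.trace_smul,
    Matrix.trace_one, Fintype.card_fin, smul_eq_mul, ← Complex.ofReal_natCast, Complex.nonneg_iff,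
    Complex.re_mul_ofReal, Complex.im_mul_ofReal] at h1
  refine ⟨z.re, nonneg_of_mul_nonneg_left h1.1 hd, ?_⟩
  rw [hz]
  congr 1
  exact Complex.ext rfl ((mul_eq_zero.mp h1.2.symm).resolve_right hd.ne')

theorem IsAngularMomentum.map_one_eq_one [NeZero d] (h : IsAngularMomentum J)
    (hE : ∀ X, (E X).trace = X.trace)
    (hc : ∀ k X, E (J k * X - X * J k) = J k * E X - E X * J k) : E 1 = 1 := by
  have hd : (d : ℂ) ≠ 0 := by exact_mod_cast NeZero.ne d
  obtain ⟨z, hz⟩ := h.exists_eq_smul_one (X := E 1) fun k => by rw [← hc]; simp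
  have h1 := hE 1
  rw [hz, Matrix.trace_smul, Matrix.trace_one, Fintype.card_fin, smul_eq_mul] at h1
  rw [hz, (mul_eq_right₀ hd).mp h1, one_smul]

/-- The three numbers that govern a covariant channel: with the Choi operator `C`, these are
`⟨1, C 1⟩ / d`, `tr C²` and `tr (C ∘ casimir)`. -/
theorem IsAngularMomentum.exists_parameters [NeZero d] (h : IsAngularMomentum J) (hd : 1 < d)
    (hE : IsQuantumChannel E)
    (hcov : ∀ k X, E (J k * X - X * J k) = J k * E X - E X * J k) :
    ∃ q S t : ℝ, 0 ≤ q ∧ q ≤ d ∧ q ^ 2 ≤ S ∧ S ≤ q ^ 2 + (d - q) ^ 2 / 3 ∧ 2 * (d - q) ≤ t ∧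
      t ≤ d * (d - 1) * (d - q) ∧ unitarity E = (S - 1) / ((d : ℝ) ^ 2 - 1) ∧
      averageTotalDeviation J E =
        (t / ((d : ℝ) * ((d : ℝ) ^ 2 - 1) / 2)) ^ 2 * ((d : ℝ) - 1) / 4 := by
  have htp := hE.tracePreserving
  have hC := isPositive_choi hE
  have hCc : ∀ k, Commute (choi E) (ad (J k)) := fun k => commute_choi (hcov k)
  obtain ⟨q, hq0, hq⟩ := h.exists_choi_one hE hCc
  obtain ⟨z, hz⟩ := h.exists_trace_map_mul hcov
  have htrC : (LinearMap.trace ℂ (Op d) (choi E)).re = d := by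
    rw [trace_choi, htp]; simp
  have hcas := h.trace_choi_mul_casimir htp hz
  have hreal := trace_mul_im_eq_zero hC.isSymmetric h.isSymmetric_casimir
  set T := LinearMap.trace ℂ (Op d) (choi E * casimir J) with hT
  refine ⟨q, (LinearMap.trace ℂ (Op d) (choi E * choi E)).re, T.re, hq0,
    htrC ▸ h.le_trace hC hCc hq, sq_le_trace_mul_self hC.isSymmetric hq,
    htrC ▸ h.trace_mul_self_le hC hCc hq, htrC ▸ h.le_trace_mul_casimir hC hq,
    htrC ▸ h.trace_mul_casimir_le hC hq, unitarity_eq hd htp (h.map_one_eq_one htp hcov), ?_⟩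
  have hd2 : (1 : ℝ) < d := by exact_mod_cast hd
  have hD0 : (d : ℝ) * ((d : ℝ) ^ 2 - 1) / 2 ≠ 0 := by
    have : 0 < (d : ℝ) ^ 2 - 1 := by nlinarith
    positivity
  have hzc : ((1 - T.re / ((d : ℝ) * ((d : ℝ) ^ 2 - 1) / 2) : ℝ) : ℂ) = z := by
    have hTre : (T.re : ℂ) = T := Complex.ext rfl hreal.symm
    have hD0' : (d : ℂ) * ((d : ℂ) ^ 2 - 1) / 2 ≠ 0 := by exact_mod_cast hD0
    push_cast
    rw [hTre, hcas, mul_div_cancel_left₀ _ hD0']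
    ring
  rw [← hzc] at hz
  rw [averageTotalDeviation_eq h hz, sub_sub_cancel]

/-- First, d² − S ≤ (d − q)(d + q) ≤ 2d(d − q) ≤ td. Second, d² − S ≥ (d − q)(2d + 4q)/3 ≥ (2d/3)(d
− q), to be compared with the upper bound on t. -/
theorem deviation_bounds {d q S t : ℝ} (hd : 2 ≤ d) (hq0 : 0 ≤ q) (hqd : q ≤ d)
    (hS1 : q ^ 2 ≤ S) (hS2 : S ≤ q ^ 2 + (d - q) ^ 2 / 3) (ht1 : 2 * (d - q) ≤ t)
    (ht2 : t ≤ d * (d - 1) * (d - q)) :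
    d ^ 2 - S ≤ t * d ∧ t ≤ 3 * (d - 1) / 2 * (d ^ 2 - S) := by
  constructor
  · nlinarith [mul_nonneg (sub_nonneg.mpr hqd) (sub_nonneg.mpr hqd)]
  · have h1 : (d - q) * (2 * d / 3) ≤ d ^ 2 - S := by
      nlinarith [mul_nonneg (sub_nonneg.mpr hqd) hq0]
    have h2 := mul_le_mul_of_nonneg_left h1 (by linarith : 0 ≤ 3 * (d - 1) / 2)
    nlinarith

end Conclusion

end SpinChannel

theorem mainTheorem3 (d : ℕ) (j : ℝ) (hj : 0 < j) (hd : (d : ℝ) = 2 * j + 1)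
    (U : SpinChannel.SU2 →* Matrix.unitaryGroup (Fin d) ℂ) (J : Fin 3 → SpinChannel.Op d)
    (hUJ : SpinChannel.IsSpinIrrep U J)
    (E : SpinChannel.Op d →ₗ[ℂ] SpinChannel.Op d)
    (hE : SpinChannel.IsQuantumChannel E) (hcov : SpinChannel.IsCovariant U E) :
    Real.sqrt 2 * j ^ (1 / 2 : ℝ) / (2 * j + 1) ^ 2 * (1 - SpinChannel.unitarity E)
        ≤ Real.sqrt (SpinChannel.averageTotalDeviation J E) ∧
      Real.sqrt (SpinChannel.averageTotalDeviation J E)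
        ≤ 3 * Real.sqrt 2 * j ^ (3 / 2 : ℝ) / (2 * j + 1) * (1 - SpinChannel.unitarity E) := by
  have hd1 : 1 < d := by
    have : (1 : ℝ) < d := by linarith
    exact_mod_cast this
  have hd2 : (2 : ℝ) ≤ d := by exact_mod_cast hd1
  have : NeZero d := ⟨by omega⟩
  obtain ⟨q, S, t, hq0, hqd, hS1, hS2, ht1, ht2, hu, hΔ⟩ :=
    hUJ.isAngularMomentum.exists_parameters hd1 hE (hcov.map_commutator hUJ)
  obtain ⟨hb1, hb2⟩ := SpinChannel.deviation_bounds hd2 hq0 hqd hS1 hS2 ht1 ht2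
  have ht0 : 0 ≤ t := by linarith
  have hj3 : j ^ (3 / 2 : ℝ) = j * Real.sqrt j := by
    rw [Real.sqrt_eq_rpow, ← Real.rpow_one_add' hj.le (by norm_num)]
    norm_num
  -- Δ is a perfect square times (d − 1)/4 = j/2, and t ≥ 0 fixes the sign of the root.
  have hsqrt : Real.sqrt (SpinChannel.averageTotalDeviation J E) =
      Real.sqrt 2 * Real.sqrt j * (t / ((d : ℝ) * ((d : ℝ) ^ 2 - 1))) := by
    rw [hΔ, ← Real.sqrt_sq (by
      have : 0 < (d : ℝ) ^ 2 - 1 := by nlinarith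
      positivity : 0 ≤ Real.sqrt 2 * Real.sqrt j * (t / ((d : ℝ) * ((d : ℝ) ^ 2 - 1))))]
    congr 1
    rw [mul_pow, mul_pow, Real.sq_sqrt zero_le_two, Real.sq_sqrt hj.le,
      show (d : ℝ) - 1 = 2 * j by linarith, div_div_eq_mul_div]
    ring
  rw [hj3, hsqrt, hu, ← Real.sqrt_eq_rpow, ← hd]
  have hd0 : (0 : ℝ) < d := by linarith
  have hdd : 0 < (d : ℝ) ^ 2 - 1 := by nlinarith
  have hs : 0 ≤ Real.sqrt 2 * Real.sqrt j := by positivity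
  have hv : 1 - (S - 1) / ((d : ℝ) ^ 2 - 1) = ((d : ℝ) ^ 2 - S) / ((d : ℝ) ^ 2 - 1) := by
    field_simp
    ring
  rw [hv]
  constructor
  · calc _ = Real.sqrt 2 * Real.sqrt j *
          (((d : ℝ) ^ 2 - S) / ((d : ℝ) ^ 2 * ((d : ℝ) ^ 2 - 1))) := by field_simp
      _ ≤ Real.sqrt 2 * Real.sqrt j * ((t * d) / ((d : ℝ) ^ 2 * ((d : ℝ) ^ 2 - 1))) := by
          gcongr
      _ = _ := by field_simp
  · calc _ ≤ Real.sqrt 2 * Real.sqrt j *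
          ((3 * ((d : ℝ) - 1) / 2 * ((d : ℝ) ^ 2 - S)) / ((d : ℝ) * ((d : ℝ) ^ 2 - 1))) := by
          gcongr
      _ = _ := by
          rw [hd]
          field_simp
          ring
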